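/- **Setting.** All vector spaces are over $\mathbb C$. For a countable index set $J$ let $\mathfrak{sl}(J)$ be the Lie algebra of trace-zero $J\times J$ matrices with finitely many nonzero entries, $E_{ij}$ the elementary matrices, and $\mathfrak{g}=\mathfrak{sl}(\infty)=\mathfrak{sl}(\mathbb Z_{>0})$, with the Cartan subalgebra $\mathfrak h$ of diagonal matrices. Weight modules are taken with respect to $\mathfrak h$ and have finite-dimensional weight spaces. *The modules $X_{\mathfrak{sl}}(\mu)$.* Let $Q_J\subset\mathbb C^J$ be the lattice generated by all $\varepsilon_i-\varepsilon_j$ ($i,j\in J$), and for $\mu\in\mathbb C^{J}$ put $\mathrm{Int}^+(\mu)=\{i:\mu_i\in\mathbb Z_{\ge0}\}$. Let $\mathfrak{sl}(J)$ act on the span of the formal monomials $\mathbf x^\lambda=\prod_i x_i^{\lambda_i}$ ($\lambda\in\mathbb C^J$) by $E_{ij}\mapsto x_i\partial_j$ (extended linearly, including to the diagonal). Let $V_{\mathfrak{sl}}(\mu)$ be the submodule spanned by all $\mathbf x^\lambda$ with $\lambda-\mu\in Q_J$ and $\mathrm{Int}^+(\mu)\subseteq\mathrm{Int}^+(\lambda)$,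 let $V_{\mathfrak{sl}}(\mu)^+$ be the sum of all $V_{\mathfrak{sl}}(\mu')$ properly contained in $V_{\mathfrak{sl}}(\mu)$, and set $X_{\mathfrak{sl}}(\mu)=V_{\mathfrak{sl}}(\mu)/V_{\mathfrak{sl}}(\mu)^+$. Write $\lambda\sim_{\mathfrak{sl}}\mu$ if $\lambda-\mu\in Q_J$ and $\mathrm{Int}^+(\lambda)=\mathrm{Int}^+(\mu)$. *Parabolic subalgebras.* Let $\prec$ be a (strict) partial order on $\mathbb Z_{>0}$, and let $[i]$ consist of $i$ and of all $j$ not comparable with $i$. Assume that $\prec$ is admissible, i.e. $[i]\ne[j]$ implies $[i]\cap[j]=\emptyset$. Let $\mathfrak l(\prec)=\mathfrak h\oplus\bigoplus\mathbb C E_{ij}$ (sum over $i\neq j$ with $[i]=[j]$), $\mathfrak u(\prec)=\bigoplus_{i\prec j}\mathbb C E_{ij}$, $\mathfrak p(\prec)=\mathfrak l(\prec)\oplus\mathfrak u(\prec)$ and $\mathfrak l(\prec)^{ss}=[\mathfrak l(\prec),\mathfrak l(\prec)]=\bigoplus_{[i]}\mathfrak{sl}([i])$. A simple weight $\mathfrak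 g$-module $M$ is $\mathfrak p(\prec)$-aligned if it is isomorphic to the simple quotient of $U(\mathfrak g)\otimes_{U(\mathfrak p(\prec))}S$ for some simple weight $\mathfrak l(\prec)$-module $S$, on which $\mathfrak u(\prec)$ acts by $0$. Put $M^{\mathfrak u(\prec)}=\{m\in M:\mathfrak u(\prec)m=0\}$. For $A,B\subseteq\mathbb Z_{>0}$ write $A\prec B$ if $a\prec b$ for all $a\in A$, $b\in B$. Let $\varepsilon_{[i]}$ be the restriction of $\varepsilon\in\mathbb C^{\mathbb Z_{>0}}$ to $[i]$, and $\mathbf c$ the constant sequence with entries $c$. Let $S(\prec)$ be the set of all $\varepsilon\in\mathbb C^{\mathbb Z_{>0}}$ such that $[i]\prec[j]$ implies $\varepsilon_{[i]}=-\mathbf 1$ or $\varepsilon_{[j]}=\mathbf 0$. **Proposition.** Let $\prec$ be an admissible partial order on $\mathbb Z_{>0}$ and $\mu\in\mathbb C^{\mathbb Z_{>0}}$. Then $X_{\mathfrak{sl}}(\mu)$ is $\mathfrak p(\prec)$-aligned if and only if $\mu\sim_{\mathfrak{sl}}\varepsilon$ for some $\varepsilon\in S(\prec)$. Moreover, for every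 $\varepsilon\in S(\prec)$ with $\mu\sim_{\mathfrak{sl}}\varepsilon$ one of the following holds: 1. There is a unique class $[i']$ with $\varepsilon_{[i']}\notin\{\mathbf 0,-\mathbf 1\}$, and either $|[i']|\ge2$ and $X_{\mathfrak{sl}}(\mu)^{\mathfrak u(\prec)}\cong X_{\mathfrak{sl}}(\varepsilon_{[i']})\boxtimes\mathbb C$ as modules over $\mathfrak l(\prec)^{ss}=\mathfrak{sl}([i'])\oplus\bigl(\bigoplus_{[j]\ne[i']}\mathfrak{sl}([j])\bigr)$, or $|[i']|=1$ and $X_{\mathfrak{sl}}(\mu)^{\mathfrak u(\prec)}\cong\mathbb C$ (the trivial module) as $\mathfrak l(\prec)^{ss}$-modules. 2. $\varepsilon_{[i]}\in\{\mathbf 0,-\mathbf 1\}$ for all $[i]$, and $X_{\mathfrak{sl}}(\mu)^{\mathfrak u(\prec)}\cong\mathbb C$ (the trivial module) as $\mathfrak l(\prec)^{ss}$-modules. -/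

import Mathlib

namespace SlInf

noncomputable section

/-! ### Finitary matrices and the Lie algebra `sl(J)` -/

/-- Matrices with rows and columns indexed by `J` and only finitely many nonzero entries;
`A (i, j)` is the `(i, j)`-entry. -/
def FinMat (J : Type) : Type := (J × J) →₀ ℂ

namespace FinMat

variable {J : Type}

instance : AddCommGroup (FinMat J) := inferInstanceAs (AddCommGroup ((J × J) →₀ ℂ))
instance : Module ℂ (FinMat J) := inferInstanceAs (Module ℂ ((J × J) →₀ ℂ))
instance : FunLike (FinMat J) (J × J) ℂ := inferInstanceAs (FunLike ((J × J) →₀ ℂ) (J × J) ℂ)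

/-- The elementary matrix `E_ij`. -/
def E (i j : J) : FinMat J := Finsupp.single (i, j) 1

@[simp] theorem add_apply (A B : FinMat J) (p : J × J) : (A + B) p = A p + B p := rfl
@[simp] theorem sub_apply (A B : FinMat J) (p : J × J) : (A - B) p = A p - B p := rfl
@[simp] theorem neg_apply (A : FinMat J) (p : J × J) : (-A) p = -A p := rfl
@[simp] theorem zero_apply (p : J × J) : (0 : FinMat J) p = 0 := rfl
@[simp] theorem smul_apply (c : ℂ) (A : FinMat J) (p : J × J) : (c • A) p = c * A p := rfl

theorem ext {A B : FinMat J} (h : ∀ i j, A (i, j) = B (i, j)) : A = B :=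
  Finsupp.ext fun p => h p.1 p.2

open Classical in
theorem E_apply (i j k l : J) : (E i j) (k, l) = if k = i ∧ l = j then 1 else 0 := by
  change (Finsupp.single (i, j) (1 : ℂ)) (k, l) = _
  rw [Finsupp.single_apply]
  simp only [Prod.mk.injEq]
  congr 1
  exact propext ⟨fun h => ⟨h.1.symm, h.2.symm⟩, fun h => ⟨h.1.symm, h.2.symm⟩⟩

theorem induction {P : FinMat J → Prop} (A : FinMat J) (h0 : P 0)
    (hadd : ∀ A B, P A → P B → P (A + B)) (hE : ∀ (c : ℂ) i j, P (c • E i j)) : P A := by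
  refine Finsupp.induction_linear (motive := P) A h0 hadd fun p c => ?_
  have h : (Finsupp.single p c : (J × J) →₀ ℂ) = c • Finsupp.single (p.1, p.2) 1 := by simp
  rw [h]
  exact hE c p.1 p.2

/-- The linear map `FinMat J → M` with prescribed values on the elementary matrices. -/
def lift {M : Type} [AddCommGroup M] [Module ℂ M] (f : J → J → M) : FinMat J →ₗ[ℂ] M :=
  Finsupp.lift M ℂ (J × J) fun p => f p.1 p.2

@[simp] theorem lift_E {M : Type} [AddCommGroup M] [Module ℂ M] (f : J → J → M) (i j : J) :
    lift f (E i j) = f i j := by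
  have h := Finsupp.lift_apply M ℂ (X := J × J) (fun p => f p.1 p.2) (Finsupp.single (i, j) 1)
  rw [Finsupp.sum_single_index (by simp), one_smul] at h
  exact h

open Classical in
/-- The matrix product as a bilinear map, determined by `E_ij E_kl = δ_jk E_il`. -/
def mulₗ : FinMat J →ₗ[ℂ] FinMat J →ₗ[ℂ] FinMat J :=
  lift fun i j => lift fun k l => if j = k then E i l else 0

open Classical in
theorem mul_E (i j k l : J) : mulₗ (E i j) (E k l) = if j = k then E i l else 0 := by
  simp [mulₗ]

theorem finite_support_mul (A B : FinMat J) (i j : J) :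
    (Function.support fun k => A (i, k) * B (k, j)).Finite := by
  refine Set.Finite.subset
    ((Finsupp.hasFiniteSupport A).preimage (f := fun k : J => (i, k)) ?_) ?_
  · intro a _ b _ h
    exact (Prod.mk.inj h).2
  · intro k hk
    exact left_ne_zero_of_mul hk

/-- The bilinear map `mulₗ` is the usual matrix product. -/
theorem mul_apply (A B : FinMat J) (i j : J) :
    mulₗ A B (i, j) = ∑ᶠ k, A (i, k) * B (k, j) := by
  classical
  induction A using induction with
  | h0 => simp
  | hadd A A' hA hA' =>
    simp only [map_add, LinearMap.add_apply, add_apply, add_mul]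
    rw [finsum_add_distrib (finite_support_mul _ _ _ _) (finite_support_mul _ _ _ _), hA, hA']
  | hE c a b =>
    induction B using induction with
    | h0 => simp
    | hadd B B' hB hB' =>
      simp only [map_add, add_apply, mul_add]
      rw [finsum_add_distrib (finite_support_mul _ _ _ _) (finite_support_mul _ _ _ _), hB, hB']
    | hE d k l =>
      rw [finsum_eq_single _ b]
      · simp only [map_smul, LinearMap.smul_apply, smul_apply, mul_E, E_apply]
        by_cases h : b = k
        · by_cases h1 : i = a <;> by_cases h2 : j = l <;> simp [h, h1, h2, E_apply, mul_comm]
        · simp [h]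
      · intro x hx
        simp [E_apply, hx]

theorem mul_assoc' (A B C : FinMat J) : mulₗ (mulₗ A B) C = mulₗ A (mulₗ B C) := by
  classical
  induction A using induction with
  | h0 => simp
  | hadd A A' hA hA' => simp only [map_add, LinearMap.add_apply, hA, hA']
  | hE c a b =>
    induction B using induction with
    | h0 => simp
    | hadd B B' hB hB' => simp only [map_add, LinearMap.add_apply, hB, hB']
    | hE d k l =>
      induction C using induction with
      | h0 => simp
      | hadd C C' hC hC' => simp only [map_add, hC, hC']
      | hE e m n =>
        simp only [map_smul, LinearMap.smul_apply, mul_E]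
        by_cases h1 : b = k <;> by_cases h2 : l = m <;> simp [h1, h2, mul_E]

/-- The Lie algebra `gl(J)` of finitary matrices with the commutator bracket. -/
instance : LieRing (FinMat J) where
  bracket A B := mulₗ A B - mulₗ B A
  add_lie A B C := by simp only [map_add, LinearMap.add_apply]; abel
  lie_add A B C := by simp only [map_add, LinearMap.add_apply]; abel
  lie_self A := sub_self _
  leibniz_lie A B C := by simp only [map_sub, LinearMap.sub_apply, mul_assoc']; abel

theorem lie_def (A B : FinMat J) : ⁅A, B⁆ = mulₗ A B - mulₗ B A := rfl

instance : LieAlgebra ℂ (FinMat J) where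
  lie_smul c A B := by simp only [lie_def, map_smul, LinearMap.smul_apply, smul_sub]

open Classical in
/-- The trace. -/
def trace : FinMat J →ₗ[ℂ] ℂ :=
  lift fun i j => if i = j then 1 else 0

open Classical in
theorem trace_E (i j : J) : trace (E i j) = if i = j then 1 else 0 := by
  simp [trace]

/-- The trace is the sum of the diagonal entries. -/
theorem trace_apply (A : FinMat J) : trace A = ∑ᶠ i, A (i, i) := by
  classical
  have hfin : ∀ A : FinMat J, (Function.support fun i => A (i, i)).Finite := fun A =>
    ((Finsupp.hasFiniteSupport A).preimage (f := fun i : J => (i, i))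
      fun a _ b _ h => (Prod.mk.inj h).1).subset fun i hi => hi
  induction A using induction with
  | h0 => simp
  | hadd A B hA hB =>
    simp only [map_add, add_apply]
    rw [finsum_add_distrib (hfin A) (hfin B), hA, hB]
  | hE c i j =>
    rw [finsum_eq_single _ i]
    · simp [trace_E, E_apply]
    · intro k hk
      simp [E_apply, hk]

theorem trace_lie (A B : FinMat J) : trace ⁅A, B⁆ = 0 := by
  classical
  rw [lie_def]
  induction A using induction with
  | h0 => simp
  | hadd A A' hA hA' =>
    simp only [map_add, LinearMap.add_apply, map_sub] at hA hA' ⊢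
    linear_combination hA + hA'
  | hE c a b =>
    induction B using induction with
    | h0 => simp
    | hadd B B' hB hB' =>
      simp only [map_add, LinearMap.add_apply, map_sub] at hB hB' ⊢
      linear_combination hB + hB'
    | hE d k l =>
      simp only [map_smul, LinearMap.smul_apply, mul_E, map_sub]
      rw [apply_ite trace, apply_ite trace, trace_E, trace_E, eq_comm (a := a), eq_comm (a := k)]
      by_cases h1 : b = k <;> by_cases h2 : l = a <;> simp [h1, h2, mul_comm]

/-- A nonzero entry of a commutator comes from nonzero entries of the factors. -/
theorem exists_of_lie_apply_ne_zero {A B : FinMat J} {i j : J} (h : ⁅A, B⁆ (i, j) ≠ 0) :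
    (∃ k, A (i, k) ≠ 0 ∧ B (k, j) ≠ 0) ∨ ∃ k, B (i, k) ≠ 0 ∧ A (k, j) ≠ 0 := by
  by_contra! hc
  apply h
  rw [lie_def, sub_apply, mul_apply, mul_apply, finsum_eq_zero_of_forall_eq_zero,
    finsum_eq_zero_of_forall_eq_zero, sub_zero]
  · intro k
    by_cases hk : B (i, k) = 0
    · simp [hk]
    · simp [hc.2 k hk]
  · intro k
    by_cases hk : A (i, k) = 0
    · simp [hk]
    · simp [hc.1 k hk]

/-- The submatrix with rows and columns in `S`. -/
def restrict (S : Set J) : FinMat J →ₗ[ℂ] FinMat S where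
  toFun A := Finsupp.comapDomain (fun p : S × S => ((p.1 : J), (p.2 : J))) A (by
    rintro ⟨a, b⟩ _ ⟨c, d⟩ _ h
    have h' := Prod.mk.inj h
    exact Prod.ext (Subtype.ext h'.1) (Subtype.ext h'.2))
  map_add' A B := by refine ext fun i j => ?_; rfl
  map_smul' c A := by refine ext fun i j => ?_; rfl

@[simp] theorem restrict_apply (S : Set J) (A : FinMat J) (i j : S) :
    restrict S A (i, j) = A ((i : J), (j : J)) := rfl

theorem restrict_mul (S : Set J) (A B : FinMat J)
    (hA : ∀ i j, A (i, j) ≠ 0 → i ∈ S → j ∈ S) :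
    restrict S (mulₗ A B) = mulₗ (restrict S A) (restrict S B) := by
  refine ext fun i j => ?_
  rw [restrict_apply, mul_apply, mul_apply]
  simp only [restrict_apply]
  rw [finsum_set_coe_eq_finsum_mem (f := fun k => A ((i : J), k) * B (k, (j : J)))]
  rw [← finsum_mem_univ]
  refine finsum_mem_inter_support_eq' _ _ _ fun k hk => ?_
  simpa using hA i k (left_ne_zero_of_mul hk) i.2

end FinMat

open FinMat

variable {J : Type}

/-- `sl(J)`: the finitary matrices of trace zero. For `J` infinite countable this is `sl(∞)`, the
direct limit of the `sl(n)` along root embeddings. -/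
def sl (J : Type) : LieSubalgebra ℂ (FinMat J) where
  toSubmodule := LinearMap.ker FinMat.trace
  lie_mem' := fun _ _ => trace_lie _ _

/-- The Cartan subalgebra of diagonal matrices. -/
def cartan (J : Type) : LieSubalgebra ℂ (sl J) where
  carrier := {A | ∀ i j, (A : FinMat J) (i, j) ≠ 0 → i = j}
  zero_mem' := by intro i j h; simp at h
  add_mem' := by
    intro A B hA hB i j h
    by_contra hij
    have h1 : (A : FinMat J) (i, j) = 0 := by by_contra h'; exact hij (hA i j h')
    have h2 : (B : FinMat J) (i, j) = 0 := by by_contra h'; exact hij (hB i j h')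
    simp [h1, h2] at h
  smul_mem' := by
    intro c A hA i j h
    exact hA i j (right_ne_zero_of_mul (a := c) h)
  lie_mem' := by
    intro A B hA hB i j h
    rcases exists_of_lie_apply_ne_zero (A := A.1) (B := B.1) h with ⟨k, h1, h2⟩ | ⟨k, h1, h2⟩
    · exact (hA _ _ h1).trans (hB _ _ h2)
    · exact (hB _ _ h1).trans (hA _ _ h2)

/-! ### Admissible partial orders and parabolic subalgebras -/

/-- `[i]`: the element `i` together with all elements not comparable with `i`. -/
def incompClass (lt : J → J → Prop) (i : J) : Set J :=
  {i} ∪ {j | ¬ lt i j ∧ ¬ lt j i}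

/-- A (strict) partial order `≺` such that distinct classes `[i]`, `[j]` are disjoint. -/
structure AdmissibleOrder (J : Type) where
  lt : J → J → Prop
  irrefl : ∀ i, ¬ lt i i
  trans : ∀ i j k, lt i j → lt j k → lt i k
  admissible : ∀ i j, incompClass lt i ≠ incompClass lt j →
    incompClass lt i ∩ incompClass lt j = ∅

namespace AdmissibleOrder

variable (o : AdmissibleOrder J)

/-- The class `[i]` of the order. -/
def block (i : J) : Set J := incompClass o.lt i

variable {o}

theorem mem_block {i j : J} : j ∈ o.block i ↔ ¬ o.lt i j ∧ ¬ o.lt j i := by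
  constructor
  · rintro (rfl | h)
    · exact ⟨o.irrefl _, o.irrefl _⟩
    · exact h
  · exact fun h => Or.inr h

theorem self_mem_block (i : J) : i ∈ o.block i := Or.inl rfl

theorem mem_block_symm {i j : J} (h : j ∈ o.block i) : i ∈ o.block j :=
  mem_block.2 (mem_block.1 h).symm

theorem block_eq {i j : J} (h : j ∈ o.block i) : o.block j = o.block i := by
  by_contra hne
  have h0 := o.admissible j i hne
  exact Set.notMem_empty j (h0 ▸ (⟨Or.inl rfl, h⟩ :
    j ∈ incompClass o.lt j ∩ incompClass o.lt i))

theorem mem_block_trans {i j k : J} (h1 : j ∈ o.block i) (h2 : k ∈ o.block j) :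
    k ∈ o.block i := block_eq h1 ▸ h2

theorem lt_of_mem_left {i j k : J} (h : o.lt i j) (hk : k ∈ o.block i) : o.lt k j := by
  by_contra h'
  by_cases h'' : o.lt j k
  · exact (mem_block.1 hk).1 (o.trans _ _ _ h h'')
  · exact (mem_block.1 (mem_block_trans hk (mem_block.2 ⟨h', h''⟩))).1 h

theorem lt_of_mem_right {i j k : J} (h : o.lt i j) (hk : k ∈ o.block j) : o.lt i k := by
  by_contra h'
  by_cases h'' : o.lt k i
  · exact (mem_block.1 hk).2 (o.trans _ _ _ h'' h)
  · exact (mem_block.1 (mem_block_trans hk (mem_block.2 ⟨h'', h'⟩))).2 h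

end AdmissibleOrder

open AdmissibleOrder

/-- The Lie subalgebra of `sl(J)` of all matrices whose nonzero entries sit at positions
`(i, j)` with `R i j`; it is spanned by root spaces and (part of) the Cartan subalgebra. -/
def supported (R : J → J → Prop) (hR : ∀ i j k, R i j → R j k → R i k) :
    LieSubalgebra ℂ (sl J) where
  carrier := {A | ∀ i j, (A : FinMat J) (i, j) ≠ 0 → R i j}
  zero_mem' := by intro i j h; simp at h
  add_mem' := by
    intro A B hA hB i j h
    by_contra hij
    have h1 : (A : FinMat J) (i, j) = 0 := by by_contra h'; exact hij (hA i j h')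
    have h2 : (B : FinMat J) (i, j) = 0 := by by_contra h'; exact hij (hB i j h')
    simp [h1, h2] at h
  smul_mem' := by
    intro c A hA i j h
    exact hA i j (right_ne_zero_of_mul (a := c) h)
  lie_mem' := by
    intro A B hA hB i j h
    rcases exists_of_lie_apply_ne_zero (A := A.1) (B := B.1) h with ⟨k, h1, h2⟩ | ⟨k, h1, h2⟩
    · exact hR _ _ _ (hA _ _ h1) (hB _ _ h2)
    · exact hR _ _ _ (hB _ _ h1) (hA _ _ h2)

variable (o : AdmissibleOrder J)

/-- `p(≺)`: the Cartan subalgebra plus the root spaces of all `ε_i - ε_j` that are positive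
(`i ≺ j`) or not comparable with `0` (`i`, `j` not comparable). -/
def parabolic : LieSubalgebra ℂ (sl J) :=
  supported (fun i j => ¬ o.lt j i) fun i j k hij hjk hki => by
    by_cases h : o.lt i j
    · exact hjk (o.trans _ _ _ hki h)
    · exact hjk (lt_of_mem_right hki (mem_block.2 ⟨h, hij⟩))

/-- `l(≺)`: the Cartan subalgebra plus the root spaces of `ε_i - ε_j`, `i`, `j` not comparable. -/
def levi : LieSubalgebra ℂ (sl J) :=
  supported (fun i j => j ∈ o.block i) fun _ _ _ => mem_block_trans

/-- `u(≺)`: the sum of the root spaces of `ε_i - ε_j`, `i ≺ j`. -/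
def nilradical : LieSubalgebra ℂ (sl J) :=
  supported (fun i j => o.lt i j) o.trans

/-- `l(≺)^ss = [l(≺), l(≺)]`. -/
abbrev leviSS : LieIdeal ℂ (levi o) := ⁅(⊤ : LieIdeal ℂ (levi o)), (⊤ : LieIdeal ℂ (levi o))⁆

theorem lie_levi_nilradical {A B : sl J} (hA : A ∈ levi o) (hB : B ∈ nilradical o) :
    ⁅B, A⁆ ∈ nilradical o := by
  intro i j h
  rcases exists_of_lie_apply_ne_zero (A := B.1) (B := A.1) h with ⟨k, h1, h2⟩ | ⟨k, h1, h2⟩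
  · exact lt_of_mem_right (hB _ _ h1) (hA _ _ h2)
  · exact lt_of_mem_left (hB _ _ h2) (mem_block_symm (hA _ _ h1))

open Classical in
/-- The matrix obtained by replacing all entries outside the diagonal blocks with `0`. -/
def blockPart : FinMat J →ₗ[ℂ] FinMat J where
  toFun A := Finsupp.filter (fun p : J × J => p.2 ∈ o.block p.1) A
  map_add' _ _ := Finsupp.filter_add
  map_smul' _ _ := Finsupp.filter_smul

open Classical in
theorem blockPart_apply (A : FinMat J) (i j : J) :
    blockPart o A (i, j) = if j ∈ o.block i then A (i, j) else 0 :=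
  Finsupp.filter_apply _ _ _

theorem blockPart_mem {A : FinMat J} (hA : A ∈ sl J) : blockPart o A ∈ sl J := by
  change trace _ = 0
  rw [trace_apply]
  simp only [blockPart_apply, self_mem_block, if_true]
  rw [← trace_apply]
  exact hA

/-- The projection `p(≺) = l(≺) ⊕ u(≺) → l(≺)`. -/
def parabolicToLevi : parabolic o →ₗ[ℂ] levi o where
  toFun A := ⟨⟨blockPart o A.1.1, blockPart_mem o A.1.2⟩, fun i j h => by
    by_contra hij
    exact h ((blockPart_apply o A.1.1 i j).trans (if_neg hij))⟩
  map_add' A B := Subtype.ext (Subtype.ext (map_add (blockPart o) A.1.1 B.1.1))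
  map_smul' c A := Subtype.ext (Subtype.ext (map_smul (blockPart o) c A.1.1))

theorem restrict_lie {A B : sl J} (hA : A ∈ levi o) (hB : B ∈ levi o) (i : J) :
    restrict (o.block i) ⁅(A : FinMat J), (B : FinMat J)⁆ =
      ⁅restrict (o.block i) (A : FinMat J), restrict (o.block i) (B : FinMat J)⁆ := by
  rw [lie_def, lie_def, map_sub, restrict_mul, restrict_mul]
  · exact fun a b h ha => mem_block_trans ha (hB a b h)
  · exact fun a b h ha => mem_block_trans ha (hA a b h)

/-- The projection of `l(≺)^ss`, the direct sum of the `sl([j])` over all classes, onto its summand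
`sl([i])`: it takes a matrix to its `[i]`-block. -/
def blockProj (i : J) : leviSS o →ₗ⁅ℂ⁆ sl (o.block i) where
  toFun A := ⟨restrict (o.block i) (A : levi o).1.1, by
    have h : leviSS o ≤ (LinearMap.ker (FinMat.trace ∘ₗ restrict (o.block i) ∘ₗ
        (sl J).toSubmodule.subtype ∘ₗ (levi o).toSubmodule.subtype) : Submodule ℂ (levi o)) := by
      refine (LieSubmodule.lieIdeal_oper_eq_linear_span' (⊤ : LieIdeal ℂ (levi o))
        (⊤ : LieIdeal ℂ (levi o))).le.trans (Submodule.span_le.2 ?_)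
      rintro _ ⟨A, _, B, _, rfl⟩
      change trace (restrict (o.block i) ⁅A.1.1, B.1.1⁆) = 0
      rw [restrict_lie o A.2 B.2, trace_lie]
    exact h A.2⟩
  map_add' A B := Subtype.ext (map_add (restrict (o.block i)) A.1.1.1 B.1.1.1)
  map_smul' c A := Subtype.ext (map_smul (restrict (o.block i)) c A.1.1.1)
  map_lie' {A B} := Subtype.ext (restrict_lie o A.1.2 B.1.2 i)

/-! ### Weight modules, generalized Verma modules, aligned modules -/

section Modules

/-- The weight space of weight `χ` with respect to the subalgebra `H`. -/
def weightSpace {L : Type} [LieRing L] [LieAlgebra ℂ L] (H : LieSubalgebra ℂ L) (M : Type)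
    [AddCommGroup M] [Module ℂ M] [LieRingModule L M] [LieModule ℂ L M]
    (χ : Module.Dual ℂ H) : Submodule ℂ M where
  carrier := {m | ∀ h : H, ⁅(h : L), m⁆ = χ h • m}
  zero_mem' := by intro h; simp
  add_mem' := by intro a b ha hb h; rw [lie_add, ha, hb, smul_add]
  smul_mem' := by intro c a ha h; rw [lie_smul, ha, smul_comm]

/-- `M` is a weight module with finite-dimensional weight spaces: it is the sum (automatically
direct) of its weight spaces. -/
def IsWeightModule {L : Type} [LieRing L] [LieAlgebra ℂ L] (H : LieSubalgebra ℂ L) (M : Type)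
    [AddCommGroup M] [Module ℂ M] [LieRingModule L M] [LieModule ℂ L M] : Prop :=
  ⨆ χ, weightSpace H M χ = ⊤ ∧ ∀ χ, FiniteDimensional ℂ (weightSpace H M χ)

attribute [local instance 100] LieRing.ofAssociativeRing

variable (S : Type) [AddCommGroup S] [Module ℂ S] [LieRingModule (levi o) S]
  [LieModule ℂ (levi o) S]

open TensorProduct

/-- The enveloping algebra of `sl(J)`. -/
abbrev U (J : Type) : Type := UniversalEnvelopingAlgebra ℂ (sl J)

/-- The generalized Verma module `U(g) ⊗_{U(p)} S`, where `p = p(≺)` acts on the `l(≺)`-module `S`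
through the projection `p → l(≺)` (that is, `u(≺) S = 0`): the quotient of `U(g) ⊗_ℂ S` by the left
`U(g)`-submodule generated by all `x ⊗ s - 1 ⊗ x s` with `x ∈ p`, `s ∈ S`. -/
def GenVerma : Type :=
  (U J ⊗[ℂ] S) ⧸ Submodule.span (U J)
    {t : U J ⊗[ℂ] S | ∃ (x : parabolic o) (s : S),
      t = UniversalEnvelopingAlgebra.ι ℂ (x : sl J) ⊗ₜ[ℂ] s - 1 ⊗ₜ[ℂ] ⁅parabolicToLevi o x, s⁆}

instance : AddCommGroup (GenVerma o S) := by unfold GenVerma; infer_instance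
instance : Module (U J) (GenVerma o S) := by unfold GenVerma; infer_instance
instance : Module ℂ (GenVerma o S) := by unfold GenVerma; infer_instance
instance : IsScalarTower ℂ (U J) (GenVerma o S) := by unfold GenVerma; infer_instance

/-- `g` acts on `U(g) ⊗_{U(p)} S` by left multiplication. -/
instance : LieRingModule (sl J) (GenVerma o S) where
  bracket x v := UniversalEnvelopingAlgebra.ι ℂ x • v
  add_lie x y v := by rw [map_add, add_smul]
  lie_add x v w := smul_add _ _ _
  leibniz_lie x y v := by
    rw [LieHom.map_lie, LieRing.of_associative_ring_bracket, sub_smul, mul_smul, mul_smul]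
    abel

instance : LieModule ℂ (sl J) (GenVerma o S) where
  smul_lie c x v := by
    change UniversalEnvelopingAlgebra.ι ℂ (c • x) • v = c • (UniversalEnvelopingAlgebra.ι ℂ x • v)
    rw [map_smul, smul_assoc]
  lie_smul c x v := by
    exact smul_comm _ _ _

variable (M : Type) [AddCommGroup M] [Module ℂ M] [LieRingModule (sl J) M] [LieModule ℂ (sl J) M]

/-- `M` is `p(≺)`-aligned: a simple weight module which is isomorphic to a simple quotient of the
generalized Verma module of some simple weight `l(≺)`-module `S`, that is, the target of a
surjective homomorphism from it. -/
def IsAligned : Prop :=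
  LieModule.IsIrreducible ℂ (sl J) M ∧ IsWeightModule (cartan J) M ∧
  ∃ (S : Type) (_ : AddCommGroup S) (_ : Module ℂ S) (_ : LieRingModule (levi o) S)
    (_ : LieModule ℂ (levi o) S),
    LieModule.IsIrreducible ℂ (levi o) S ∧
    IsWeightModule ((cartan J).comap (levi o).incl) S ∧
    ∃ f : GenVerma o S →ₗ⁅ℂ, sl J⁆ M, Function.Surjective f

/-- `M^{u(≺)}`, as an `l(≺)`-submodule of `M`. -/
def invariants : LieSubmodule ℂ (levi o) M where
  carrier := {m | ∀ x ∈ nilradical o, ⁅x, m⁆ = 0}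
  zero_mem' := by intro x _; simp
  add_mem' := by intro a b ha hb x hx; rw [lie_add, ha x hx, hb x hx, add_zero]
  smul_mem' := by intro c a ha x hx; rw [lie_smul, ha x hx, smul_zero]
  lie_mem := by
    intro A m hm x hx
    change ⁅x, ⁅(A : sl J), m⁆⁆ = 0
    rw [leibniz_lie, hm x hx, lie_zero, add_zero]
    exact hm _ (lie_levi_nilradical o A.2 hx)

end Modules

/-! ### The modules `X(μ)` -/

/-- The span of the formal monomials `x^λ = ∏ x_i^{λ_i}`, `λ : J → ℂ`. -/
def Monomials (J : Type) : Type := (J → ℂ) →₀ ℂ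

instance : AddCommGroup (Monomials J) := inferInstanceAs (AddCommGroup ((J → ℂ) →₀ ℂ))
instance : Module ℂ (Monomials J) := inferInstanceAs (Module ℂ ((J → ℂ) →₀ ℂ))

/-- The monomial `x^λ`. -/
def mono (l : J → ℂ) : Monomials J := Finsupp.single l 1

/-- The linear endomorphism with prescribed values on monomials. -/
def monoLift (f : (J → ℂ) → Monomials J) : Module.End ℂ (Monomials J) :=
  Finsupp.lift (Monomials J) ℂ (J → ℂ) f

@[simp] theorem monoLift_mono (f : (J → ℂ) → Monomials J) (l : J → ℂ) :
    monoLift f (mono l) = f l := by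
  have h := Finsupp.lift_apply (Monomials J) ℂ (X := J → ℂ) f (Finsupp.single l 1)
  rw [Finsupp.sum_single_index (by simp), one_smul] at h
  exact h

theorem mono_hom_ext {f g : Module.End ℂ (Monomials J)} (h : ∀ l, f (mono l) = g (mono l)) :
    f = g := by
  refine Finsupp.lhom_ext' (M := ℂ) fun l => LinearMap.ext_ring ?_
  exact h l

open Classical in
/-- The sequence `ε_i` with entry `1` at `i` and `0` elsewhere. -/
def e (i : J) : J → ℂ := fun k => if k = i then 1 else 0

/-- Multiplication by `x_i`. -/
def xOp (i : J) : Module.End ℂ (Monomials J) := monoLift fun l => mono (l + e i)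

/-- The partial derivative `∂_j`. -/
def dOp (j : J) : Module.End ℂ (Monomials J) := monoLift fun l => l j • mono (l - e j)

theorem xOp_comm (i j : J) : xOp i * xOp j = xOp j * xOp i :=
  mono_hom_ext fun l => by simp [xOp, add_right_comm]

theorem dOp_comm (i j : J) : dOp i * dOp j = dOp j * dOp i := by
  refine mono_hom_ext fun l => ?_
  by_cases h : i = j
  · rw [h]
  · simp [dOp, e, h, Ne.symm h, smul_smul, mul_comm, sub_right_comm]

open Classical in
theorem dOp_xOp (i j : J) : dOp j * xOp i = xOp i * dOp j + if j = i then 1 else 0 := by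
  refine mono_hom_ext fun l => ?_
  by_cases h : j = i
  · subst h
    simp [dOp, xOp, e, add_smul]
  · simp [dOp, xOp, e, h, add_sub_right_comm]

attribute [local instance 100] LieRing.ofAssociativeRing

/-- The homomorphism `E_ij ↦ x_i ∂_j`. -/
def weylHom : FinMat J →ₗ⁅ℂ⁆ Module.End ℂ (Monomials J) where
  toLinearMap := FinMat.lift fun i j => xOp i * dOp j
  map_lie' {A B} := by
    classical
    change FinMat.lift _ ⁅A, B⁆ = ⁅FinMat.lift _ A, FinMat.lift _ B⁆
    rw [FinMat.lie_def, LieRing.of_associative_ring_bracket]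
    induction A using FinMat.induction with
    | h0 => simp
    | hadd A A' hA hA' =>
      simp only [map_add, LinearMap.add_apply, map_sub, add_mul, mul_add] at hA hA' ⊢
      rw [add_sub_add_comm, hA, hA', add_sub_add_comm]
    | hE c i j =>
      induction B using FinMat.induction with
      | h0 => simp
      | hadd B B' hB hB' =>
        simp only [map_add, LinearMap.add_apply, map_sub, add_mul, mul_add] at hB hB' ⊢
        rw [add_sub_add_comm, hB, hB', add_sub_add_comm]
      | hE d k l =>
        simp only [map_smul, LinearMap.smul_apply, map_sub, FinMat.mul_E, FinMat.lift_E,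
          smul_mul_smul_comm, apply_ite (FinMat.lift fun i j : J => xOp i * dOp j), map_zero]
        rw [smul_smul, smul_smul, mul_comm d c, ← smul_sub, ← smul_sub]
        congr 1
        have h1 : xOp i * dOp j * (xOp k * dOp l) =
            xOp i * xOp k * (dOp j * dOp l) + if j = k then xOp i * dOp l else 0 := by
          rw [mul_assoc, ← mul_assoc (dOp j), dOp_xOp]
          split_ifs <;> noncomm_ring
        have h2 : xOp k * dOp l * (xOp i * dOp j) =
            xOp i * xOp k * (dOp j * dOp l) + if l = i then xOp k * dOp j else 0 := by
          rw [mul_assoc, ← mul_assoc (dOp l), dOp_xOp, xOp_comm i k, dOp_comm j l]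
          split_ifs <;> noncomm_ring
        rw [h1, h2]
        abel

instance : LieRingModule (FinMat J) (Monomials J) :=
  LieRingModule.compLieHom (Monomials J) weylHom

instance : LieModule ℂ (FinMat J) (Monomials J) :=
  LieModule.compLieHom (Monomials J) weylHom

/-- The root lattice of `sl(J)`, generated by all `ε_i - ε_j`. -/
def rootLattice (J : Type) : AddSubgroup (J → ℂ) :=
  AddSubgroup.closure {q | ∃ i j : J, q = e i - e j}

/-- `Int⁺(μ)`, the set of all `i` such that `μ_i` is a nonnegative integer. -/
def intPlus (μ : J → ℂ) : Set J := {i | ∃ n : ℕ, μ i = n}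

theorem weylHom_E_mono (i j : J) (l : J → ℂ) :
    weylHom (E i j) (mono l) = l j • mono (l - e j + e i) := by
  change FinMat.lift (fun i j : J => xOp i * dOp j) (E i j) (mono l) = _
  simp [xOp, dOp]

theorem intPlus_shift {μ l : J → ℂ} (h : intPlus μ ⊆ intPlus l) (i j : J) (hj : l j ≠ 0) :
    intPlus μ ⊆ intPlus (l - e j + e i) := by
  intro k hk
  obtain ⟨n, hn⟩ := h hk
  by_cases hkj : k = j
  · subst hkj
    have hn0 : n ≠ 0 := by rintro rfl; exact hj (by simpa using hn)
    obtain ⟨m, rfl⟩ := Nat.exists_eq_succ_of_ne_zero hn0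
    by_cases hki : k = i
    · subst hki
      exact ⟨m + 1, by simp [e, hn]⟩
    · exact ⟨m, by simp [e, hn, hki]⟩
  · by_cases hki : k = i
    · subst hki
      exact ⟨n + 1, by simp [e, hn, hkj]⟩
    · exact ⟨n, by simp [e, hn, hki, hkj]⟩

/-- `V(μ)`, the span of all `x^λ` with `λ - μ` in the root lattice and `Int⁺(μ) ⊆ Int⁺(λ)`. -/
def V (μ : J → ℂ) : LieSubmodule ℂ (sl J) (Monomials J) where
  toSubmodule := Submodule.span ℂ {m | ∃ l : J → ℂ,
    l - μ ∈ rootLattice J ∧ intPlus μ ⊆ intPlus l ∧ m = mono l}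
  lie_mem := by
    intro x m hm
    change weylHom x.1 m ∈ Submodule.span ℂ _
    replace hm : m ∈ Submodule.span ℂ _ := hm
    induction x.1 using FinMat.induction with
    | h0 => simp
    | hadd A B hA hB =>
      rw [map_add]
      exact add_mem hA hB
    | hE c i j =>
      rw [map_smul]
      refine Submodule.smul_mem _ _ ?_
      induction hm using Submodule.span_induction with
      | zero => simp
      | add m m' _ _ h h' => rw [map_add]; exact add_mem h h'
      | smul c m _ h => rw [map_smul]; exact Submodule.smul_mem _ _ h
      | mem m hm =>
        obtain ⟨l, hl, hl', rfl⟩ := hm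
        rw [weylHom_E_mono]
        by_cases hj : l j = 0
        · simp [hj]
        · refine Submodule.smul_mem _ _ (Submodule.subset_span ⟨_, ?_, intPlus_shift hl' i j hj, rfl⟩)
          have h : l - e j + e i - μ = (l - μ) + (e i - e j) := by abel
          rw [h]
          exact add_mem hl (AddSubgroup.subset_closure ⟨i, j, rfl⟩)

/-- `V(μ)⁺`, the sum of all `V(μ')` properly contained in `V(μ)`. -/
def VPlus (μ : J → ℂ) : LieSubmodule ℂ (sl J) (Monomials J) :=
  ⨆ μ' : {μ' : J → ℂ // V μ' < V μ}, V μ'.1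

/-- `X(μ) = V(μ) / V(μ)⁺`. -/
abbrev X (μ : J → ℂ) : Type := V μ ⧸ (VPlus μ).comap (V μ).incl

/-- `λ ∼ μ`: `λ - μ` is in the root lattice and `Int⁺(λ) = Int⁺(μ)`. -/
def Equivalent (l μ : J → ℂ) : Prop := l - μ ∈ rootLattice J ∧ intPlus l = intPlus μ

/-- `S(≺)`: the sequences `ε` such that `[i] ≺ [j]` implies that `ε` is constantly `-1` on `[i]` or
constantly `0` on `[j]`. -/
def admissibleSeqs : Set (J → ℂ) :=
  {ε | ∀ i j, (∀ a ∈ o.block i, ∀ b ∈ o.block j, o.lt a b) →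
    (∀ a ∈ o.block i, ε a = -1) ∨ (∀ b ∈ o.block j, ε b = 0)}

/-- `X(ε_[i]) ⊠ ℂ` as a module over `l(≺)^ss = sl([i]) ⊕ (⨁_{[j] ≠ [i]} sl([j]))`: the space
`X(ε_[i])`, on which `sl([i])` acts as usual and the other summands act by zero. -/
def BoxTrivial (i : J) (ε : J → ℂ) : Type := X (fun j : o.block i => ε j)

instance (i : J) (ε : J → ℂ) : AddCommGroup (BoxTrivial o i ε) :=
  inferInstanceAs (AddCommGroup (X (fun j : o.block i => ε j)))
instance (i : J) (ε : J → ℂ) : Module ℂ (BoxTrivial o i ε) :=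
  inferInstanceAs (Module ℂ (X (fun j : o.block i => ε j)))
instance (i : J) (ε : J → ℂ) : LieRingModule (leviSS o) (BoxTrivial o i ε) :=
  LieRingModule.compLieHom (X (fun j : o.block i => ε j)) (blockProj o i)
instance (i : J) (ε : J → ℂ) : LieModule ℂ (leviSS o) (BoxTrivial o i ε) :=
  LieModule.compLieHom (X (fun j : o.block i => ε j)) (blockProj o i)

end
end SlInf

namespace SlInf

noncomputable section

open FinMat AdmissibleOrder

section

/-! ### Linear maps on finitary matrices, and the elements `E_ij` and `E_ii - E_jj` of `sl(J)` -/

namespace FinMat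
variable {J M N : Type} [AddCommGroup M] [Module ℂ M] [AddCommGroup N] [Module ℂ N]

/-! The module X(μ) has a basis of monomials x^l with l ∼ μ (`basisX`). For i ≠ j, `E_ij` sends x^l
to l_j x^(l - e_j + e_i), and this vanishes in X(μ) exactly when l_j = 0 or l_i = -1: these are the
two ways in which a unit cannot move from j to i without an entry crossing between -1 and 0. The
diagonal matrices separate the monomials, so every submodule stable under them is spanned by
monomials (`basis_mem_of_repr_ne_zero`). Any two equivalent exponents are joined by permitted moves
(`basisX_mem_of_mem`), hence X(μ) is simple.

By the same vanishing rule, x^l is killed by u(≺) exactly when i ≺ j implies l_i = -1 or l_j = 0,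
which says l ∈ S(≺) (`basisX_mem_invariants_iff`). So the invariants have as basis the monomials
with exponent in S(≺). A simple module is a quotient of a generalized Verma module only if it has
nonzero u(≺)-invariants. Conversely, nonzero invariants of X(μ) form a simple weight l(≺)-module,
and their inclusion extends to a surjection from the generalized Verma module. This gives the
criterion `isAligned_X_iff`.

For the structure of the invariants, the main combinatorial fact is that equivalent elements of S(≺)
differ inside a single class (`mem_block_of_differ`). A class on which ε is neither constantly 0 nor
constantly -1 forces 0 on everything above it and -1 on everything below it, so it is unique and all
variation takes place there. Restricting exponents to it identifies the invariants with X(ε_[i]);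
the other classes contribute only a character, which is zero on the derived algebra
(`IsMixed.restrictX_lie`). If there is no such class, or it is a singleton, the exponent cannot
vary, and the derived algebra kills a one-dimensional module. -/

theorem lift_apply (f : J → J → M) (A : FinMat J) :
    lift f A = Finsupp.sum A fun p c => c • f p.1 p.2 := rfl

theorem lift_congr {f g : J → J → M} {A : FinMat J}
    (h : ∀ i j, A (i, j) ≠ 0 → f i j = g i j) : lift f A = lift g A := by
  rw [lift_apply, lift_apply]
  refine Finset.sum_congr rfl fun p hp => ?_
  exact congrArg _ (h p.1 p.2 (Finsupp.mem_support_iff.1 hp))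

theorem linearMap_ext {f g : FinMat J →ₗ[ℂ] M} (h : ∀ i j, f (E i j) = g (E i j)) : f = g := by
  ext A
  induction A using FinMat.induction with
  | h0 => simp
  | hadd A B hA hB => simp [hA, hB]
  | hE c i j => simp [h]

theorem map_lift (g : M →ₗ[ℂ] N) (f : J → J → M) (A : FinMat J) :
    g (lift f A) = lift (fun i j => g (f i j)) A := by
  have h : g ∘ₗ lift f = lift (fun i j => g (f i j)) := linearMap_ext fun i j => by simp
  exact congrArg (fun k => k A) h

open Classical in
theorem restrict_E (S : Set J) (i j : J) :
    restrict S (E i j) =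
      if h : i ∈ S ∧ j ∈ S then E (⟨i, h.1⟩ : S) (⟨j, h.2⟩ : S) else 0 := by
  refine ext fun a b => ?_
  rw [restrict_apply, E_apply]
  split_ifs with h1 h2 h2
  · rw [E_apply, if_pos ⟨Subtype.ext h1.1, Subtype.ext h1.2⟩]
  · exact (h2 ⟨h1.1 ▸ a.2, h1.2 ▸ b.2⟩).elim
  · rw [E_apply, if_neg]
    rintro ⟨rfl, rfl⟩
    exact h1 ⟨rfl, rfl⟩
  · rfl

end FinMat

/-- The off-diagonal elementary matrix `E_ij` as an element of `sl(J)`. -/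
def slE {J : Type} {i j : J} (h : i ≠ j) : sl J :=
  ⟨E i j, by
    change FinMat.trace _ = 0
    rw [trace_E, if_neg h]⟩

/-- The element `E_ii - E_jj` of `sl(J)`. -/
def slH {J : Type} (i j : J) : sl J :=
  ⟨E i i - E j j, by
    change FinMat.trace _ = 0
    rw [map_sub, trace_E, trace_E, if_pos rfl, if_pos rfl, sub_self]⟩

variable {J : Type}

theorem slH_mem_cartan (i j : J) : slH i j ∈ cartan J := by
  intro a b h
  by_contra hab
  apply h
  change (E i i - E j j : FinMat J) (a, b) = 0
  rw [sub_apply, E_apply, E_apply, if_neg, if_neg, sub_self]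
  · rintro ⟨rfl, rfl⟩; exact hab rfl
  · rintro ⟨rfl, rfl⟩; exact hab rfl

/-! ### The root lattice -/

theorem e_self (i : J) : e i i = 1 := if_pos rfl

theorem e_of_ne {i k : J} (h : k ≠ i) : e i k = 0 := if_neg h

theorem e_sub_e_mem_rootLattice (i j : J) : e i - e j ∈ rootLattice J :=
  AddSubgroup.subset_closure ⟨i, j, rfl⟩

/-- The root lattice consists of the finitely supported integral sequences with sum zero. -/
theorem mem_rootLattice_iff {q : J → ℂ} :
    q ∈ rootLattice J ↔ ∃ z : J →₀ ℤ, (z.sum fun _ n => n) = 0 ∧ ∀ i, q i = z i := by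
  classical
  constructor
  · intro h
    induction h using AddSubgroup.closure_induction with
    | mem q hq =>
      obtain ⟨i, j, rfl⟩ := hq
      refine ⟨Finsupp.single i 1 - Finsupp.single j 1, ?_, fun k => ?_⟩
      · rw [Finsupp.sum_sub_index (fun _ _ _ => rfl)]
        simp
      · simp [e, Finsupp.single_apply, eq_comm]
    | zero => exact ⟨0, by simp, by simp⟩
    | add p q _ _ hp hq =>
      obtain ⟨y, hy, hy'⟩ := hp
      obtain ⟨z, hz, hz'⟩ := hq
      refine ⟨y + z, ?_, fun i => by simp [hy', hz']⟩
      rw [Finsupp.sum_add_index' (fun _ => rfl) (fun _ _ _ => rfl), hy, hz, add_zero]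
    | neg q _ hq =>
      obtain ⟨z, hz, hz'⟩ := hq
      refine ⟨-z, ?_, fun i => by simp [hz']⟩
      rw [Finsupp.sum_neg_index (fun _ => rfl)]
      simpa [Finsupp.sum] using hz
  · rintro ⟨z, hz, hq⟩
    by_cases h0 : z.support.Nonempty
    · obtain ⟨i, -⟩ := h0
      -- Any fixed index i serves as base point: the `e i` terms cancel because the entries of z sum
      -- to zero.
      have h : q = ∑ k ∈ z.support, z k • (e k - e i) := by
        have hz' : ∑ k ∈ z.support, (z k : ℂ) = 0 := by
          rw [← Int.cast_sum]
          exact_mod_cast hz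
        funext a
        rw [hq, Finset.sum_apply]
        simp only [Pi.smul_apply, Pi.sub_apply, smul_sub, Finset.sum_sub_distrib, zsmul_eq_mul]
        rw [← Finset.sum_mul, hz', zero_mul, sub_zero]
        simp [e]
      rw [h]
      exact sum_mem fun k _ => zsmul_mem (e_sub_e_mem_rootLattice k i) _
    · have : q = 0 := by
        funext a
        rw [Finset.not_nonempty_iff_eq_empty, Finsupp.support_eq_empty] at h0
        simp [hq, h0]
      rw [this]
      exact zero_mem _

/-- A nonzero element of the root lattice has entries of both signs. -/
theorem exists_pos_and_neg {z : J →₀ ℤ} (hz : (z.sum fun _ n => n) = 0) (h : z ≠ 0) :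
    (∃ i, 0 < z i) ∧ ∃ j, z j < 0 := by
  obtain ⟨k, hk⟩ := Finsupp.ne_iff.1 h
  have hk' : ∃ k ∈ z.support, z k ≠ 0 := ⟨k, Finsupp.mem_support_iff.2 hk, hk⟩
  obtain ⟨i, -, hi⟩ := Finset.exists_pos_of_sum_zero_of_exists_nonzero _ hz hk'
  have hz' : ∑ k ∈ z.support, -z k = 0 := by
    rw [Finset.sum_neg_distrib, neg_eq_zero]
    exact hz
  obtain ⟨j, -, hj⟩ := Finset.exists_pos_of_sum_zero_of_exists_nonzero _ hz'
    ⟨k, Finsupp.mem_support_iff.2 hk, neg_ne_zero.2 hk⟩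
  exact ⟨⟨i, hi⟩, j, neg_pos.1 hj⟩

/-! ### Equivalence of weights -/

theorem Equivalent.refl (l : J → ℂ) : Equivalent l l := ⟨by simp, rfl⟩

theorem Equivalent.symm {l m : J → ℂ} (h : Equivalent l m) : Equivalent m l :=
  ⟨by simpa using neg_mem h.1, h.2.symm⟩

theorem Equivalent.trans {l m n : J → ℂ} (h : Equivalent l m) (h' : Equivalent m n) :
    Equivalent l n :=
  ⟨by simpa using add_mem h.1 h'.1, h.2.trans h'.2⟩

theorem Equivalent.exists_finsupp {l m : J → ℂ} (h : Equivalent l m) :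
    ∃ z : J →₀ ℤ, (z.sum fun _ n => n) = 0 ∧ ∀ i, l i = m i + z i := by
  obtain ⟨z, hz, hz'⟩ := mem_rootLattice_iff.1 h.1
  exact ⟨z, hz, fun i => by rw [← hz' i, Pi.sub_apply]; ring⟩

/-- Equivalence is compatible with the signs of integral entries. -/
theorem Equivalent.nonneg_iff {l m : J → ℂ} (h : Equivalent l m) {i : J} {a b : ℤ}
    (ha : l i = a) (hb : m i = b) : 0 ≤ a ↔ 0 ≤ b := by
  have key : ∀ {l : J → ℂ} {a : ℤ}, l i = a → (i ∈ intPlus l ↔ 0 ≤ a) := by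
    intro l a ha
    constructor
    · rintro ⟨n, hn⟩
      have : a = n := by exact_mod_cast ha.symm.trans hn
      omega
    · intro h
      exact ⟨a.toNat, by rw [ha]; exact_mod_cast (Int.toNat_of_nonneg h).symm⟩
  rw [← key ha, ← key hb, h.2]

/-- Moving a unit from the `j`-th to the `i`-th entry preserves the equivalence class if the
entries do not cross from `0` to `-1` or back. -/
theorem equivalent_shift {l : J → ℂ} {i j : J} (hij : i ≠ j) (hj : l j ≠ 0) (hi : l i ≠ -1) :
    Equivalent (l - e j + e i) l := by
  refine ⟨by simpa [sub_add_eq_add_sub, add_sub_assoc] using e_sub_e_mem_rootLattice i j,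
    Set.Subset.antisymm ?_ (intPlus_shift subset_rfl i j hj)⟩
  rintro k ⟨n, hn⟩
  by_cases hki : k = i
  · subst hki
    have h : l k + 1 = n := by simpa [e, hij] using hn
    cases n with
    | zero => exact (hi (by push_cast at h; linear_combination h)).elim
    | succ n => exact ⟨n, by push_cast at h; linear_combination h⟩
  · by_cases hkj : k = j
    · subst hkj
      have h : l k - 1 = n := by simpa [e, hki] using hn
      exact ⟨n + 1, by push_cast; linear_combination h⟩
    · exact ⟨n, by simpa [e, hki, hkj] using hn⟩

/-- The i-th entry rises from -1 to 0, so i newly enters Int⁺. In X(μ) the shifted monomial is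
therefore zero. -/
theorem not_equivalent_shift {l : J → ℂ} {i j : J} (hij : i ≠ j) (hi : l i = -1) :
    ¬ Equivalent (l - e j + e i) l := by
  intro h
  have := h.nonneg_iff (i := i) (a := 0) (b := -1) (by simp [e, hij, hi]) (by simp [hi])
  omega

end

section

variable {J : Type}

/-! ### The monomial basis of `X(μ)` -/

/-- The coefficient of the monomial `x^l`. -/
def coeff (l : J → ℂ) : Monomials J →ₗ[ℂ] ℂ :=
  (Finsupp.lapply l : ((J → ℂ) →₀ ℂ) →ₗ[ℂ] ℂ)

/-- Being spanned by basis monomials, V(μ) is a space of finitely supported functions with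
prescribed support, so membership can be tested coefficientwise. -/
theorem mem_V_iff {μ : J → ℂ} {m : Monomials J} :
    m ∈ V μ ↔ ∀ l, coeff l m ≠ 0 → l - μ ∈ rootLattice J ∧ intPlus μ ⊆ intPlus l := by
  have h : (V μ).toSubmodule = Finsupp.supported ℂ ℂ
      {l : J → ℂ | l - μ ∈ rootLattice J ∧ intPlus μ ⊆ intPlus l} := by
    rw [Finsupp.supported_eq_span_single]
    change Submodule.span ℂ _ = _
    congr 1
    ext m
    constructor
    · rintro ⟨l, h1, h2, rfl⟩
      exact ⟨l, ⟨h1, h2⟩, rfl⟩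
    · rintro ⟨l, h, rfl⟩
      exact ⟨l, h.1, h.2, rfl⟩
  rw [← LieSubmodule.mem_toSubmodule, h]
  refine (Finsupp.mem_supported ℂ _).trans ⟨fun h l hl => h (Finsupp.mem_support_iff.2 hl),
    fun h l hl => h l (Finsupp.mem_support_iff.1 hl)⟩

theorem mono_mem_V {μ l : J → ℂ} (h : l - μ ∈ rootLattice J) (h' : intPlus μ ⊆ intPlus l) :
    mono l ∈ V μ :=
  Submodule.subset_span ⟨l, h, h', rfl⟩

theorem V_le_V {μ ν : J → ℂ} (h : ν - μ ∈ rootLattice J) (h' : intPlus μ ⊆ intPlus ν) :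
    V ν ≤ V μ := fun m hm => mem_V_iff.2 fun l hl => by
  obtain ⟨h1, h2⟩ := mem_V_iff.1 hm l hl
  exact ⟨by simpa using add_mem h1 h, h'.trans h2⟩

theorem coeff_mono_self (l : J → ℂ) : coeff l (mono l) = 1 := Finsupp.single_eq_same

open Classical in
theorem coeff_mono (k l : J → ℂ) : coeff k (mono l) = if l = k then 1 else 0 :=
  Finsupp.single_apply

theorem of_mono_mem_V {μ l : J → ℂ} (h : mono l ∈ V μ) :
    l - μ ∈ rootLattice J ∧ intPlus μ ⊆ intPlus l :=
  mem_V_iff.1 h l (by rw [coeff_mono_self]; exact one_ne_zero)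

/-- `V(μ)⁺` is spanned by the monomials of `V(μ)` that are not equivalent to `x^μ`. -/
theorem mem_VPlus_iff {μ : J → ℂ} {m : Monomials J} :
    m ∈ VPlus μ ↔ m ∈ V μ ∧ ∀ l, Equivalent l μ → coeff l m = 0 := by
  constructor
  · intro hm
    refine ⟨iSup_le (fun ν : {ν // V ν < V μ} => ν.2.le) hm, fun l hl => ?_⟩
    have hK : (VPlus μ).toSubmodule ≤ LinearMap.ker (coeff l) := by
      rw [VPlus, LieSubmodule.iSup_toSubmodule]
      refine iSup_le fun ν m hm => ?_
      by_contra h0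
      -- If V(ν) contained a monomial equivalent to x^μ, then Int⁺(ν) would lie in Int⁺(μ), and V(ν)
      -- would contain all of V(μ).
      obtain ⟨h1, h2⟩ := mem_V_iff.1 hm l h0
      obtain ⟨h3, h4⟩ := of_mono_mem_V (ν.2.le (mono_mem_V (μ := ν.1) (by simp) subset_rfl))
      refine ν.2.not_ge (V_le_V ?_ ?_)
      · rw [← neg_sub]
        exact neg_mem h3
      · rw [← hl.2]
        exact h2
    exact hK hm
  · rintro ⟨hm, h0⟩
    have h : m = Finsupp.sum m fun l c => c • mono l := by
      have := (Finsupp.sum_single (m : (J → ℂ) →₀ ℂ)).symm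
      refine this.trans (Finset.sum_congr rfl fun l _ => ?_)
      change _ = coeff l m • Finsupp.single l (1 : ℂ)
      rw [Finsupp.smul_single_one]
      rfl
    rw [h]
    refine sum_mem fun l hl => Submodule.smul_mem _ _ ?_
    have hl' := Finsupp.mem_support_iff.1 hl
    obtain ⟨h1, h2⟩ := mem_V_iff.1 hm l hl'
    -- A monomial x^l of V(μ) with l not equivalent to μ lies in V(l), which is itself one of the
    -- proper submodules in the sum.
    refine (le_iSup (fun ν : {ν // V ν < V μ} => V ν.1) ⟨l, (V_le_V h1 h2).lt_of_ne ?_⟩)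
      (mono_mem_V (by simp) subset_rfl)
    intro h3
    have h4 := of_mono_mem_V (l := μ) (μ := l) (h3 ▸ mono_mem_V (by simp) subset_rfl)
    exact hl' (h0 l ⟨h1, h4.2.antisymm h2⟩)

/-- The coefficients of the monomials equivalent to `x^μ`. -/
def coeffs (μ : J → ℂ) : V μ →ₗ[ℂ] ({l : J → ℂ // Equivalent l μ} →₀ ℂ) :=
  (Finsupp.lsubtypeDomain {l : J → ℂ | Equivalent l μ} : ((J → ℂ) →₀ ℂ) →ₗ[ℂ] _) ∘ₗ
    (V μ).toSubmodule.subtype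

theorem coeffs_apply (μ : J → ℂ) (v : V μ) (l : {l : J → ℂ // Equivalent l μ}) :
    coeffs μ v l = coeff l.1 v.1 := rfl

/-- The monomial `x^l` as an element of `V(μ)`. -/
def monoV {μ : J → ℂ} (l : {l : J → ℂ // Equivalent l μ}) : V μ :=
  ⟨mono l.1, mono_mem_V l.2.1 l.2.2.ge⟩

theorem coeffs_monoV {μ : J → ℂ} (l : {l : J → ℂ // Equivalent l μ}) :
    coeffs μ (monoV l) = Finsupp.single l 1 := by
  classical
  ext k
  rw [coeffs_apply, monoV, coeff_mono]
  simp [Finsupp.single_apply, Subtype.ext_iff]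

theorem ker_coeffs (μ : J → ℂ) :
    LinearMap.ker (coeffs μ) = ((VPlus μ).comap (V μ).incl).toSubmodule := by
  ext v
  rw [LinearMap.mem_ker, LieSubmodule.mem_toSubmodule, LieSubmodule.mem_comap]
  refine Iff.trans ?_ (mem_VPlus_iff (μ := μ) (m := v.1)).symm
  rw [and_iff_right v.2]
  exact ⟨fun h l hl => DFunLike.congr_fun h ⟨l, hl⟩, fun h => Finsupp.ext fun l => h l.1 l.2⟩

theorem coeffs_surjective (μ : J → ℂ) : Function.Surjective (coeffs μ) := by
  intro f
  refine ⟨f.sum fun l c => c • monoV l, ?_⟩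
  rw [map_finsuppSum]
  simp only [map_smul, coeffs_monoV, Finsupp.smul_single_one]
  exact f.sum_single

/-- The basis of `X(μ)` consisting of the classes of the monomials equivalent to `x^μ`. -/
def basisX (μ : J → ℂ) : Module.Basis {l : J → ℂ // Equivalent l μ} ℂ (X μ) :=
  .ofRepr ((Submodule.quotEquivOfEq _ _ (ker_coeffs μ).symm).trans
    ((coeffs μ).quotKerEquivOfSurjective (coeffs_surjective μ)))

theorem basisX_repr_mk (μ : J → ℂ) (v : V μ) :
    (basisX μ).repr (LieSubmodule.Quotient.mk' _ v) = coeffs μ v := rfl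

theorem basisX_apply {μ : J → ℂ} (l : {l : J → ℂ // Equivalent l μ}) :
    basisX μ l = LieSubmodule.Quotient.mk' _ (monoV l) := by
  apply (basisX μ).repr.injective
  rw [basisX_repr_mk, coeffs_monoV, Module.Basis.repr_self]

open Classical in
/-- The class of `x^l` in `X(μ)`, which is zero if `l` is not equivalent to `μ`. -/
def monoX (μ l : J → ℂ) : X μ := if h : Equivalent l μ then basisX μ ⟨l, h⟩ else 0

theorem monoX_of_equivalent {μ l : J → ℂ} (h : Equivalent l μ) : monoX μ l = basisX μ ⟨l, h⟩ :=
  dif_pos h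

theorem monoX_of_not_equivalent {μ l : J → ℂ} (h : ¬ Equivalent l μ) : monoX μ l = 0 :=
  dif_neg h

theorem basisX_eq_monoX {μ : J → ℂ} (l : {l : J → ℂ // Equivalent l μ}) :
    basisX μ l = monoX μ l.1 := (monoX_of_equivalent l.2).symm

-- The action of `sl(J)` on the monomial basis, and weights

attribute [local instance 100] LieRing.ofAssociativeRing

theorem weylHom_mono (A : FinMat J) (l : J → ℂ) :
    weylHom A (mono l) = FinMat.lift (fun i j => l j • mono (l - e j + e i)) A := by
  have h : (LinearMap.applyₗ (mono l) : Module.End ℂ (Monomials J) →ₗ[ℂ] Monomials J) ∘ₗ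
      (weylHom (J := J)).toLinearMap =
        FinMat.lift (fun i j => l j • mono (l - e j + e i)) :=
    linearMap_ext fun i j => by
      rw [lift_E]
      exact weylHom_E_mono i j l
  exact congrArg (fun f => f A) h

/-- The action of `sl(J)` on the monomial basis of `X(μ)`. -/
theorem lie_basisX {μ : J → ℂ} (A : sl J) (l : {l : J → ℂ // Equivalent l μ}) :
    ⁅A, basisX μ l⁆ = FinMat.lift (fun i j => l.1 j • monoX μ (l.1 - e j + e i)) A.1 := by
  classical
  apply (basisX μ).repr.injective
  ext k
  rw [basisX_apply, ← LieModuleHom.map_lie, basisX_repr_mk, coeffs_apply]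
  change coeff k.1 (weylHom A.1 (mono l.1)) = (Finsupp.lapply k ∘ₗ (basisX μ).repr.toLinearMap) _
  rw [weylHom_mono, map_lift, map_lift]
  refine lift_congr fun i j _ => ?_
  rw [map_smul, map_smul, coeff_mono]
  congr 1
  by_cases h : Equivalent (l.1 - e j + e i) μ
  · rw [monoX_of_equivalent h]
    simp [Finsupp.single_apply, Subtype.ext_iff]
  · rw [monoX_of_not_equivalent h, map_zero, if_neg]
    rintro h'
    exact h (h' ▸ k.2)

theorem slE_lie_basisX {μ : J → ℂ} {i j : J} (h : i ≠ j) (l : {l : J → ℂ // Equivalent l μ}) :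
    ⁅slE h, basisX μ l⁆ = l.1 j • monoX μ (l.1 - e j + e i) := by
  rw [lie_basisX]
  exact lift_E _ _ _

open Classical in
/-- The weight of the monomial `x^l`, as a functional on all matrices. -/
def weight (l : J → ℂ) : FinMat J →ₗ[ℂ] ℂ := FinMat.lift fun i j => if i = j then l i else 0

theorem weight_slH (l : J → ℂ) (i j : J) : weight l (slH i j).1 = l i - l j := by
  change weight l (E i i - E j j) = _
  rw [map_sub]
  simp [weight]

theorem lie_basisX_of_mem_cartan {μ : J → ℂ} {A : sl J} (hA : A ∈ cartan J)
    (l : {l : J → ℂ // Equivalent l μ}) : ⁅A, basisX μ l⁆ = weight l.1 A.1 • basisX μ l := by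
  have h : weight l.1 A.1 • basisX μ l =
      (LinearMap.toSpanSingleton ℂ (X μ) (basisX μ l)) (weight l.1 A.1) := rfl
  rw [lie_basisX, h, weight, map_lift]
  refine lift_congr fun i j hij => ?_
  obtain rfl := hA i j hij
  rw [if_pos rfl, sub_add_cancel, ← basisX_eq_monoX]
  rfl

/-- Distinct equivalent weights are separated by the Cartan subalgebra. -/
theorem exists_weight_ne {l m : J → ℂ} (h : Equivalent l m) (hne : l ≠ m) :
    ∃ i j, weight l (slH i j).1 ≠ weight m (slH i j).1 := by
  obtain ⟨z, hz, hl⟩ := h.exists_finsupp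
  have h0 : z ≠ 0 := by
    rintro rfl
    exact hne (funext fun i => by simp [hl])
  obtain ⟨⟨i, hi⟩, j, hj⟩ := exists_pos_and_neg hz h0
  -- The values of the two weights on `E_ii - E_jj` differ by z i - z j, which is positive.
  refine ⟨i, j, fun h => ?_⟩
  rw [weight_slH, weight_slH, hl, hl] at h
  have h' : (z i : ℂ) = z j := by linear_combination h
  have : z i = z j := by exact_mod_cast h'
  omega

end

section

variable {J : Type}

/-! ### Modules with a basis of weight vectors -/

/-- A submodule stable under operators that are diagonal in a basis and separate its elements
contains every basis vector occurring in one of its elements. -/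
theorem basis_mem_of_repr_ne_zero {ι M : Type} [AddCommGroup M] [Module ℂ M]
    (b : Module.Basis ι ℂ M) (N : Submodule ℂ M)
    (hsep : ∀ k l, k ≠ l → ∃ (T : M →ₗ[ℂ] M) (w : ι → ℂ),
      (∀ m ∈ N, T m ∈ N) ∧ (∀ i, T (b i) = w i • b i) ∧ w k ≠ w l)
    {m : M} (hm : m ∈ N) {l : ι} (hl : b.repr m l ≠ 0) : b l ∈ N := by
  induction hn : (b.repr m).support.card using Nat.strong_induction_on generalizing m with
  | _ n ih =>
    by_cases h : ∃ k, k ≠ l ∧ b.repr m k ≠ 0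
    · obtain ⟨k, hkl, hk⟩ := h
      obtain ⟨T, w, hT, hw, hne⟩ := hsep k l hkl
      -- Applying T - w k removes `b k` from the support and only rescales the coefficient of `b l`
      -- by a nonzero factor.
      have hrepr : ∀ i, b.repr (T m - w k • m) i = (w i - w k) * b.repr m i := by
        intro i
        have h : Finsupp.lapply i ∘ₗ b.repr.toLinearMap ∘ₗ T =
            w i • Finsupp.lapply i ∘ₗ b.repr.toLinearMap := by
          classical
          refine b.ext fun j => ?_
          simp only [LinearMap.comp_apply, hw, LinearEquiv.coe_coe, map_smul,
            Module.Basis.repr_self, Finsupp.lapply_apply, LinearMap.smul_apply,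
            Finsupp.single_apply, smul_eq_mul]
          split_ifs with h
          · rw [h]
          · simp
        have h' : b.repr (T m) i = w i * b.repr m i := LinearMap.congr_fun h m
        simp [h', sub_mul]
      refine ih _ ?_ (show T m - w k • m ∈ N from N.sub_mem (hT m hm) (N.smul_mem _ hm)) ?_ rfl
      · rw [← hn]
        refine Finset.card_lt_card ⟨fun i hi => ?_, fun hsub => ?_⟩
        · rw [Finsupp.mem_support_iff, hrepr] at hi
          exact Finsupp.mem_support_iff.2 (right_ne_zero_of_mul hi)
        · have := hsub (Finsupp.mem_support_iff.2 hk)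
          rw [Finsupp.mem_support_iff, hrepr] at this
          simp at this
      · rw [hrepr]
        exact mul_ne_zero (sub_ne_zero.2 hne.symm) hl
    · push Not at h
      have h1 : m = b.repr m l • b l := by
        apply b.repr.injective
        ext k
        by_cases hk : k = l
        · subst hk; simp
        · simp [h k hk, Ne.symm hk]
      rw [h1] at hm
      exact (N.smul_mem_iff hl).1 hm

section

variable {ι L M : Type} [LieRing L] [LieAlgebra ℂ L] [AddCommGroup M] [Module ℂ M]
  [LieRingModule L M] [LieModule ℂ L M]

/-- Separation places some basis vector in every nonzero submodule; connectivity then places all of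
them there. -/
theorem isIrreducible_of_basis (b : Module.Basis ι ℂ M) [Nonempty ι]
    (hsep : ∀ k l, k ≠ l → ∃ (x : L) (w : ι → ℂ), (∀ i, ⁅x, b i⁆ = w i • b i) ∧ w k ≠ w l)
    (hconn : ∀ (N : LieSubmodule ℂ L M) (k l : ι), b k ∈ N → b l ∈ N) :
    LieModule.IsIrreducible ℂ L M := by
  have : Nontrivial M := ⟨⟨b (Classical.arbitrary ι), 0, b.ne_zero _⟩⟩
  refine LieModule.IsIrreducible.mk fun N hN => ?_
  obtain ⟨m, hm, hm0⟩ := Submodule.exists_mem_ne_zero_of_ne_bot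
    (mt (LieSubmodule.toSubmodule_eq_bot N).1 hN)
  have : b.repr m ≠ 0 := fun h => hm0 (b.repr.map_eq_zero_iff.1 h)
  obtain ⟨k, hk⟩ := Finsupp.ne_iff.1 this
  have hbk : b k ∈ N := by
    refine basis_mem_of_repr_ne_zero b N.toSubmodule (fun i j hij => ?_) hm hk
    obtain ⟨x, w, hw, hne⟩ := hsep i j hij
    exact ⟨LieModule.toEnd ℂ L M x, w, fun m hm => N.lie_mem hm, hw, hne⟩
  rw [← LieSubmodule.toSubmodule_eq_top, eq_top_iff, ← b.span_eq, Submodule.span_le]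
  rintro _ ⟨l, rfl⟩
  exact hconn N k l hbk

/-- Since distinct basis vectors have distinct weights, each weight space is zero or a line spanned
by a basis vector. -/
theorem isWeightModule_of_basis (b : Module.Basis ι ℂ M) (H : LieSubalgebra ℂ L) (w : ι → Module.Dual ℂ H)
    (hw : ∀ (h : H) i, ⁅(h : L), b i⁆ = w i h • b i) (hinj : Function.Injective w) :
    IsWeightModule H M := by
  have hb : ∀ i, b i ∈ weightSpace H M (w i) := fun i h => hw h i
  constructor
  · rw [eq_top_iff, ← b.span_eq, Submodule.span_le]
    rintro _ ⟨i, rfl⟩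
    exact Submodule.mem_iSup_of_mem (w i) (hb i)
  · intro χ
    have key : ∀ m ∈ weightSpace H M χ, ∀ i, b.repr m i ≠ 0 → w i = χ := by
      intro m hm i hi
      ext h
      have h1 : Finsupp.lapply i ∘ₗ b.repr.toLinearMap ∘ₗ LieModule.toEnd ℂ L M (h : L) =
          w i h • Finsupp.lapply i ∘ₗ b.repr.toLinearMap := by
        classical
        refine b.ext fun j => ?_
        simp only [LinearMap.comp_apply, LieModule.toEnd_apply_apply, hw, LinearEquiv.coe_coe,
          map_smul, Module.Basis.repr_self, Finsupp.lapply_apply, LinearMap.smul_apply,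
          Finsupp.single_apply, smul_eq_mul]
        split_ifs with h
        · rw [h]
        · simp
      have h2 : b.repr ⁅(h : L), m⁆ i = w i h * b.repr m i := LinearMap.congr_fun h1 m
      rw [hm h] at h2
      simp only [map_smul, Finsupp.smul_apply, smul_eq_mul] at h2
      exact (mul_right_cancel₀ hi h2).symm
    by_cases hχ : ∃ i, w i = χ
    · obtain ⟨i, rfl⟩ := hχ
      have hle : weightSpace H M (w i) ≤ ℂ ∙ b i := by
        intro m hm
        rw [Submodule.mem_span_singleton]
        refine ⟨b.repr m i, b.repr.injective (Finsupp.ext fun k => ?_)⟩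
        by_cases hk : k = i
        · subst hk; simp
        · have : b.repr m k = 0 := by
            by_contra h
            exact hk (hinj (key m hm k h))
          simp [this, Ne.symm hk]
      exact Submodule.finiteDimensional_of_le hle
    · have h0 : weightSpace H M χ = ⊥ := by
        rw [eq_bot_iff]
        intro m hm
        rw [Submodule.mem_bot, ← b.repr.map_eq_zero_iff]
        ext i
        by_contra h
        exact hχ ⟨i, key m hm i h⟩
      rw [h0]
      infer_instance

/-- The derived algebra acts by zero on a one-dimensional module. -/
theorem lie_derived_eq_zero (b : Module.Basis ι ℂ M) [Unique ι]
    (x : (⁅(⊤ : LieIdeal ℂ L), (⊤ : LieIdeal ℂ L)⁆ : LieIdeal ℂ L)) (m : M) : ⁅(x : L), m⁆ = 0 := by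
  have hscalar : ∀ y : L, ∃ c : ℂ, ∀ m : M, ⁅y, m⁆ = c • m := by
    intro y
    refine ⟨b.repr ⁅y, b default⁆ default, fun m => ?_⟩
    have h1 : ∀ m : M, m = b.repr m default • b default := fun m => by
      conv_lhs => rw [← b.sum_repr m]
      simp
    conv_lhs => rw [h1 m, lie_smul, h1 ⁅y, b default⁆]
    conv_rhs => rw [h1 m]
    rw [smul_comm]
  have h : (⁅(⊤ : LieIdeal ℂ L), (⊤ : LieIdeal ℂ L)⁆ : LieIdeal ℂ L).toSubmodule ≤
      LinearMap.ker (LieModule.toEnd ℂ L M : L →ₗ[ℂ] Module.End ℂ M) := by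
    rw [LieSubmodule.lieIdeal_oper_eq_linear_span']
    refine Submodule.span_le.2 ?_
    rintro _ ⟨y, _, z, _, rfl⟩
    obtain ⟨c, hc⟩ := hscalar y
    obtain ⟨d, hd⟩ := hscalar z
    refine LinearMap.mem_ker.2 (LinearMap.ext fun m => ?_)
    change ⁅⁅y, z⁆, m⁆ = 0
    rw [lie_lie, hd, hc, hc, hd, smul_comm, sub_self]
  exact LinearMap.congr_fun (LinearMap.mem_ker.1 (h x.2)) m

end

/-! ### Connectivity -/

/-- In a subspace of `X(μ)` stable under all `E_ij` with `i ≠ j` in a set `B`, one can change the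
entries of a monomial in `B`. -/
theorem basisX_mem_of_mem {μ : J → ℂ} (N : Submodule ℂ (X μ)) (B : Set J)
    (hN : ∀ i ∈ B, ∀ j ∈ B, ∀ h : i ≠ j, ∀ m ∈ N, ⁅slE h, m⁆ ∈ N)
    (k l : {l : J → ℂ // Equivalent l μ}) (hkl : ∀ i ∉ B, k.1 i = l.1 i) (hk : basisX μ k ∈ N) :
    basisX μ l ∈ N := by
  classical
  obtain ⟨z, hz, hz'⟩ := (l.2.trans k.2.symm).exists_finsupp
  -- The induction is on the ℓ¹-distance between the exponents. One unit is moved from an index j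
  -- where k is too large to an index i where it is too small.
  induction hn : (z.sum fun _ n => n.natAbs) using Nat.strong_induction_on
    generalizing z k with
  | _ n ih =>
    by_cases h0 : z = 0
    · have : k = l := Subtype.ext (funext fun i => by simp [hz', h0])
      exact this ▸ hk
    · obtain ⟨⟨i, hi⟩, j, hj⟩ := exists_pos_and_neg hz h0
      have hij : i ≠ j := by rintro rfl; omega
      have hB : ∀ a, z a ≠ 0 → a ∈ B := by
        intro a ha
        by_contra haB
        have := hkl a haB
        rw [hz' a, left_eq_add] at this
        exact ha (by exact_mod_cast this)
      -- The move is permitted because the target l is equivalent to k: an entry 0 cannot have to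
      -- decrease, and an entry -1 cannot have to increase.
      have hkj : k.1 j ≠ 0 := by
        intro h
        have := (l.2.trans k.2.symm).nonneg_iff (i := j) (a := z j) (b := 0)
          (by rw [hz', h, zero_add]) (by simp [h])
        omega
      have hki : k.1 i ≠ -1 := by
        intro h
        have := (l.2.trans k.2.symm).nonneg_iff (i := i) (a := -1 + z i) (b := -1)
          (by rw [hz', h]; push_cast; rfl) (by simp [h])
        omega
      have heq : Equivalent (k.1 - e j + e i) μ := (equivalent_shift hij hkj hki).trans k.2
      have hmem : basisX μ ⟨_, heq⟩ ∈ N := by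
        have := hN i (hB i hi.ne') j (hB j hj.ne) hij _ hk
        rwa [slE_lie_basisX, monoX_of_equivalent heq, N.smul_mem_iff hkj] at this
      let z' : J →₀ ℤ := z + Finsupp.single j 1 - Finsupp.single i 1
      have hz'i : z' i = z i - 1 := by simp [z', hij.symm]
      have hz'j : z' j = z j + 1 := by simp [z', hij]
      have hz'a : ∀ a, a ≠ i → a ≠ j → z' a = z a := fun a h1 h2 => by
        simp [z', h1.symm, h2.symm]
      have hsupp : z'.support ⊆ z.support := by
        intro a ha
        rw [Finsupp.mem_support_iff] at ha ⊢
        by_cases h1 : a = i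
        · rw [h1]; exact hi.ne'
        by_cases h2 : a = j
        · rw [h2]; exact hj.ne
        rwa [hz'a a h1 h2] at ha
      refine ih (z'.sum fun _ n => n.natAbs) ?_ ⟨_, heq⟩ (fun a ha => ?_) hmem z' ?_ (fun a => ?_)
        rfl
      · rw [← hn, Finsupp.sum_of_support_subset _ hsupp _ (fun _ _ => rfl)]
        refine Finset.sum_lt_sum (fun a _ => ?_) ⟨i, Finsupp.mem_support_iff.2 hi.ne', ?_⟩
        · change (z' a).natAbs ≤ (z a).natAbs
          by_cases h1 : a = i
          · subst h1; rw [hz'i]; omega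
          by_cases h2 : a = j
          · subst h2; rw [hz'j]; omega
          rw [hz'a a h1 h2]
        · change (z' i).natAbs < (z i).natAbs
          rw [hz'i]; omega
      · have h1 : a ≠ i := fun h => ha (h ▸ hB i hi.ne')
        have h2 : a ≠ j := fun h => ha (h ▸ hB j hj.ne)
        simp [e_of_ne h1, e_of_ne h2, hkl a ha]
      · rw [Finsupp.sum_sub_index (fun _ _ _ => rfl),
          Finsupp.sum_add_index' (fun _ => rfl) (fun _ _ _ => rfl), hz]
        simp
      · rw [hz' a]
        simp only [Pi.add_apply, Pi.sub_apply, z', Finsupp.sub_apply, Finsupp.add_apply, e,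
          Finsupp.single_apply, eq_comm (a := a)]
        push_cast
        ring

/-! ### `X(μ)` is a simple weight module -/

theorem X_separated {μ : J → ℂ} (k l : {l : J → ℂ // Equivalent l μ}) (h : k ≠ l) :
    ∃ x ∈ cartan J, weight k.1 x.1 ≠ weight l.1 x.1 := by
  obtain ⟨i, j, hij⟩ := exists_weight_ne (k.2.trans l.2.symm) (Subtype.coe_ne_coe.2 h)
  exact ⟨slH i j, slH_mem_cartan i j, hij⟩

theorem X_isIrreducible (μ : J → ℂ) : LieModule.IsIrreducible ℂ (sl J) (X μ) := by
  have : Nonempty {l : J → ℂ // Equivalent l μ} := ⟨⟨μ, .refl μ⟩⟩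
  refine isIrreducible_of_basis (basisX μ) (fun k l h => ?_) fun N k l hk => ?_
  · obtain ⟨x, hx, hne⟩ := X_separated k l h
    exact ⟨x, fun l => weight l.1 x.1, lie_basisX_of_mem_cartan hx, hne⟩
  · exact basisX_mem_of_mem N.toSubmodule Set.univ (fun i _ j _ h m hm => N.lie_mem hm) k l
      (fun i hi => (hi trivial).elim) hk

theorem X_isWeightModule (μ : J → ℂ) : IsWeightModule (cartan J) (X μ) := by
  refine isWeightModule_of_basis (basisX μ) (cartan J)
    (fun l => weight l.1 ∘ₗ (sl J).toSubmodule.subtype ∘ₗ (cartan J).toSubmodule.subtype)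
    (fun h l => lie_basisX_of_mem_cartan h.2 l) fun k l h => ?_
  by_contra hne
  obtain ⟨x, hx, hx'⟩ := X_separated k l hne
  exact hx' (LinearMap.congr_fun h ⟨x, hx⟩)

end

section

variable {J : Type}

/-! ### Generalized Verma modules -/

section GenVerma

open TensorProduct

attribute [local instance 100] LieRing.ofAssociativeRing

variable {o : AdmissibleOrder J} {S : Type} [AddCommGroup S] [Module ℂ S]
  [LieRingModule (levi o) S]

/-- The elements satisfying P form a subalgebra A through which ι factors. By the universal
property, the induced map U(g) → A followed by the inclusion is the identity, so A is everything. -/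
theorem U_induction {P : U J → Prop} (u : U J) (hι : ∀ x, P (UniversalEnvelopingAlgebra.ι ℂ x))
    (hc : ∀ c : ℂ, P (algebraMap ℂ (U J) c)) (hadd : ∀ u v, P u → P v → P (u + v))
    (hmul : ∀ u v, P u → P v → P (u * v)) : P u := by
  let A : Subalgebra ℂ (U J) :=
    { carrier := {u | P u}
      mul_mem' := fun ha hb => hmul _ _ ha hb
      add_mem' := fun ha hb => hadd _ _ ha hb
      algebraMap_mem' := hc }
  let f : sl J →ₗ⁅ℂ⁆ A :=
    { toFun := fun x => ⟨UniversalEnvelopingAlgebra.ι ℂ x, hι x⟩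
      map_add' := fun x y => Subtype.ext (map_add _ x y)
      map_smul' := fun c x => Subtype.ext (map_smul _ c x)
      map_lie' := fun {x y} => Subtype.ext (LieHom.map_lie _ x y) }
  have h : A.val.comp (UniversalEnvelopingAlgebra.lift ℂ f) = AlgHom.id ℂ (U J) := by
    refine UniversalEnvelopingAlgebra.hom_ext ℂ (LieHom.ext fun x => ?_)
    change ((UniversalEnvelopingAlgebra.lift ℂ f (UniversalEnvelopingAlgebra.ι ℂ x) : A) : U J) = _
    rw [UniversalEnvelopingAlgebra.lift_ι_apply]
    rfl
  have h' := (UniversalEnvelopingAlgebra.lift ℂ f u).2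
  have h'' : ((UniversalEnvelopingAlgebra.lift ℂ f u : A) : U J) = u := DFunLike.congr_fun h u
  rwa [h''] at h'

variable (o S) in
/-- The projection `U(g) ⊗ S → U(g) ⊗_{U(p)} S`. -/
def genVermaMk : U J ⊗[ℂ] S →ₗ[U J] GenVerma o S := Submodule.mkQ _

theorem genVermaMk_surjective : Function.Surjective (genVermaMk o S) := Submodule.mkQ_surjective _

theorem genVermaMk_relation (x : parabolic o) (s : S) :
    ⁅(x : sl J), genVermaMk o S (1 ⊗ₜ s)⁆ = genVermaMk o S (1 ⊗ₜ ⁅parabolicToLevi o x, s⁆) := by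
  change UniversalEnvelopingAlgebra.ι ℂ (x : sl J) • genVermaMk o S (1 ⊗ₜ s) = _
  rw [← map_smul, smul_tmul', smul_eq_mul, mul_one]
  refine (Submodule.Quotient.eq _).2 (Submodule.subset_span ⟨x, s, rfl⟩)

theorem nilradical_le_parabolic : nilradical o ≤ parabolic o := fun _ hx i j h h' =>
  o.irrefl i (o.trans _ _ _ (hx i j h) h')

theorem parabolicToLevi_of_mem_nilradical {x : parabolic o} (hx : x.1 ∈ nilradical o) :
    parabolicToLevi o x = 0 := by
  classical
  refine Subtype.ext (Subtype.ext (FinMat.ext fun i j => ?_))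
  change blockPart o x.1.1 (i, j) = 0
  rw [blockPart_apply]
  split_ifs with h
  · by_contra h'
    exact (mem_block.1 h).1 (hx i j h')
  · rfl

variable {M : Type} [AddCommGroup M] [Module ℂ M] [LieRingModule (sl J) M] [LieModule ℂ (sl J) M]

/-- The vectors 1 ⊗ s generate the generalized Verma module and are killed by u(≺), so f maps them
into the invariants. Were these zero, f would vanish. -/
theorem invariants_ne_bot_of_surjective [Nontrivial M] (f : GenVerma o S →ₗ⁅ℂ, sl J⁆ M)
    (hf : Function.Surjective f) : invariants o M ≠ ⊥ := by
  intro hbot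
  have hgen : ∀ s, f (genVermaMk o S (1 ⊗ₜ s)) = 0 := by
    intro s
    rw [← LieSubmodule.mem_bot (R := ℂ) (L := levi o), ← hbot]
    intro x hx
    rw [← LieModuleHom.map_lie, genVermaMk_relation ⟨x, nilradical_le_parabolic hx⟩,
      parabolicToLevi_of_mem_nilradical hx, zero_lie, tmul_zero, map_zero, map_zero]
  have hu : ∀ (u : U J) (v : GenVerma o S), f v = 0 → f (u • v) = 0 := by
    intro u
    induction u using U_induction with
    | hι x =>
      intro v hv
      change f ⁅x, v⁆ = 0
      rw [LieModuleHom.map_lie, hv, lie_zero]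
    | hc c =>
      intro v hv
      rw [algebraMap_smul, map_smul, hv, smul_zero]
    | hadd u u' h h' =>
      intro v hv
      rw [add_smul, map_add, h v hv, h' v hv, add_zero]
    | hmul u u' h h' =>
      intro v hv
      rw [mul_smul]
      exact h _ (h' _ hv)
  have hzero : ∀ v, f v = 0 := by
    intro v
    obtain ⟨t, rfl⟩ := genVermaMk_surjective v
    induction t with
    | zero => simp
    | add t t' h h' => rw [map_add, map_add, h, h', add_zero]
    | tmul u s =>
      have : u ⊗ₜ[ℂ] s = u • ((1 : U J) ⊗ₜ[ℂ] s) := by rw [smul_tmul', smul_eq_mul, mul_one]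
      rw [this, map_smul]
      exact hu u _ (hgen s)
  obtain ⟨m, hm⟩ := exists_ne (0 : M)
  obtain ⟨v, rfl⟩ := hf m
  exact hm (hzero v)

/-- An element of p(≺) differs from its l(≺)-part by an element of u(≺), which kills s. This is the
compatibility needed to map the generalized Verma module of the invariants to M. -/
theorem lie_invariants_eq (x : parabolic o) (s : invariants o M) :
    ⁅x.1, s.1⁆ = ((⁅parabolicToLevi o x, s⁆ : invariants o M) : M) := by
  have h : x.1 - (parabolicToLevi o x).1 ∈ nilradical o := by
    classical
    intro i j hij
    have hij' : x.1.1 (i, j) - blockPart o x.1.1 (i, j) ≠ 0 := hij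
    rw [blockPart_apply] at hij'
    by_cases hb : j ∈ o.block i
    · simp [hb] at hij'
    · rw [if_neg hb, sub_zero] at hij'
      by_contra hlt
      exact hb (mem_block.2 ⟨hlt, x.2 i j hij'⟩)
  have h' := s.2 _ h
  rw [sub_lie, sub_eq_zero] at h'
  exact h'

variable (o M) in
/-- The inclusion `M^{u(≺)} → M` extends to the generalized Verma module. -/
theorem exists_genVerma_hom : ∃ f : GenVerma o (invariants o M) →ₗ⁅ℂ, sl J⁆ M,
    ∀ s, f (genVermaMk o (invariants o M) (1 ⊗ₜ s)) = s := by
  let φ : U J →ₐ[ℂ] Module.End ℂ M := UniversalEnvelopingAlgebra.lift ℂ (LieModule.toEnd ℂ (sl J) M)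
  have hφ : ∀ x m, φ (UniversalEnvelopingAlgebra.ι ℂ x) m = ⁅x, m⁆ := fun x m => by
    rw [UniversalEnvelopingAlgebra.lift_ι_apply]
    rfl
  let _ : Module (U J) M := Module.compHom M φ.toRingHom
  have hsmul : ∀ (u : U J) (m : M), u • m = φ u m := fun _ _ => rfl
  let F : U J ⊗[ℂ] (invariants o M) →ₗ[U J] M :=
    { toFun := TensorProduct.lift (φ.toLinearMap.compl₂ (invariants o M).toSubmodule.subtype)
      map_add' := map_add _
      map_smul' := fun u t => by
        induction t with
        | zero => simp
        | add t t' h h' => simp only [smul_add, map_add] at h h' ⊢; rw [h, h']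
        | tmul v s => simp [smul_tmul', hsmul] }
  have hF : ∀ u s, F (u ⊗ₜ s) = φ u s.1 := fun u s => rfl
  have hker : Submodule.span (U J) {t : U J ⊗[ℂ] (invariants o M) |
      ∃ (x : parabolic o) (s : invariants o M), t =
        UniversalEnvelopingAlgebra.ι ℂ (x : sl J) ⊗ₜ[ℂ] s - 1 ⊗ₜ[ℂ] ⁅parabolicToLevi o x, s⁆} ≤
      LinearMap.ker F := by
    refine Submodule.span_le.2 ?_
    rintro _ ⟨x, s, rfl⟩
    refine LinearMap.mem_ker.2 ?_
    rw [map_sub, hF, hF, hφ, map_one, sub_eq_zero]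
    exact lie_invariants_eq x s
  let G : GenVerma o (invariants o M) →ₗ[U J] M := Submodule.liftQ _ F hker
  refine ⟨{ toFun := G, map_add' := map_add G, map_smul' := fun c v => ?_, map_lie' := ?_ }, ?_⟩
  · rw [← algebraMap_smul (U J) c v, map_smul, hsmul, AlgHom.commutes]
    rfl
  · intro x v
    exact (map_smul G _ v).trans (hφ x _)
  · intro s
    change F (1 ⊗ₜ s) = _
    rw [hF, map_one]
    rfl

/-- The image of the extended inclusion contains the invariants, hence is a nonzero submodule of a
simple module. -/
theorem exists_genVerma_surjective [LieModule.IsIrreducible ℂ (sl J) M]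
    (h : invariants o M ≠ ⊥) :
    ∃ f : GenVerma o (invariants o M) →ₗ⁅ℂ, sl J⁆ M, Function.Surjective f := by
  obtain ⟨f, hf⟩ := exists_genVerma_hom o M
  refine ⟨f, ?_⟩
  rw [← LieModuleHom.range_eq_top]
  refine (eq_bot_or_eq_top f.range).resolve_left fun hbot => h ?_
  rw [LieSubmodule.eq_bot_iff]
  intro m hm
  have : f (genVermaMk o _ (1 ⊗ₜ ⟨m, hm⟩)) ∈ f.range := ⟨_, rfl⟩
  rwa [hbot, hf] at this

end GenVerma

end

section

variable {J : Type} {o : AdmissibleOrder J}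

/-! ### Combinatorics of `S(≺)` -/

/-- The order depends only on classes. A pointwise alternative upgrades to a classwise one: a bad
entry a of the lower class and a bad entry b of the upper class would be a bad pair. -/
theorem mem_admissibleSeqs_iff {l : J → ℂ} :
    l ∈ admissibleSeqs o ↔ ∀ a b, o.lt a b → l a = -1 ∨ l b = 0 := by
  constructor
  · intro h a b hab
    exact (h a b fun c hc d hd => lt_of_mem_right (lt_of_mem_left hab hc) hd).imp
      (fun h => h a (self_mem_block a)) fun h => h b (self_mem_block b)
  · intro h i j hij
    by_contra! hne
    obtain ⟨⟨a, ha, ha'⟩, b, hb, hb'⟩ := hne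
    exact (h a b (hij a ha b hb)).elim ha' hb'

theorem lt_or_lt_of_notMem_block {a b : J} (h : b ∉ o.block a) : o.lt a b ∨ o.lt b a := by
  rw [mem_block] at h
  tauto

/-- Since k - l is nonzero with sum zero, k exceeds l at some c. If c ≺ b, then l c = -1 and k c ≥
0; otherwise a ≺ c, so k c = 0 and l c < 0. Both contradict Int⁺(k) = Int⁺(l). -/
theorem not_differ_of_lt {l k : J → ℂ} (hl : l ∈ admissibleSeqs o) (hk : k ∈ admissibleSeqs o)
    (h : Equivalent k l) {a b : J} (hab : o.lt a b) (hb : k b ≠ l b) (hka : k a ≠ -1)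
    (hlb : l b ≠ 0) : False := by
  rw [mem_admissibleSeqs_iff] at hl hk
  obtain ⟨z, hz, hz'⟩ := h.exists_finsupp
  have h0 : z ≠ 0 := by
    rintro rfl
    exact hb (by simp [hz'])
  obtain ⟨⟨c, hc⟩, -⟩ := exists_pos_and_neg hz h0
  by_cases hcb : o.lt c b
  · have hlc := (hl c b hcb).resolve_right hlb
    have := h.nonneg_iff (i := c) (a := -1 + z c) (b := -1)
      (by rw [hz', hlc]; push_cast; rfl) (by rw [hlc]; simp)
    omega
  · have hac : o.lt a c := by
      by_cases hbc : o.lt b c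
      · exact o.trans _ _ _ hab hbc
      · exact lt_of_mem_right hab (mem_block.2 ⟨hbc, hcb⟩)
    have hkc := (hk a c hac).resolve_left hka
    have := h.nonneg_iff (i := c) (a := 0) (b := -z c) (by rw [hkc]; simp)
      (by have := hz' c; rw [hkc] at this; push_cast; linear_combination -this)
    omega

/-- Equivalent elements of `S(≺)` differ in at most one class. -/
theorem mem_block_of_differ {l k : J → ℂ} (hl : l ∈ admissibleSeqs o) (hk : k ∈ admissibleSeqs o)
    (h : Equivalent k l) {a b : J} (ha : k a ≠ l a) (hb : k b ≠ l b) : b ∈ o.block a := by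
  have key : ∀ {a b : J}, k a ≠ l a → k b ≠ l b → ¬ o.lt a b := by
    intro a b ha hb hab
    have hl' := mem_admissibleSeqs_iff.1 hl a b hab
    have hk' := mem_admissibleSeqs_iff.1 hk a b hab
    -- Both cases satisfy the hypotheses of `not_differ_of_lt`, with the roles of k and l exchanged
    -- when k a = -1.
    by_cases hka : k a = -1
    · have hla : l a ≠ -1 := fun h => ha (hka.trans h.symm)
      have hlb := hl'.resolve_left hla
      exact not_differ_of_lt hk hl h.symm hab hb.symm hla fun h => hb (h.trans hlb.symm)
    · have hkb := hk'.resolve_left hka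
      exact not_differ_of_lt hl hk h hab hb hka fun h => hb (hkb.trans h.symm)
  exact mem_block.2 ⟨key ha hb, key hb ha⟩

/-- The class `[i]` carries values of `ε` other than constant `0` or constant `-1`. -/
def IsMixed (o : AdmissibleOrder J) (ε : J → ℂ) (i : J) : Prop :=
  ¬ (∀ a ∈ o.block i, ε a = 0) ∧ ¬ (∀ a ∈ o.block i, ε a = -1)

variable {ε l : J → ℂ} {i : J}

/-- A mixed class has an entry different from -1, which forces 0 above the class, and an entry
different from 0, which forces -1 below it. -/
theorem IsMixed.eq_of_lt (h : IsMixed o ε i) (hl : l ∈ admissibleSeqs o)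
    (hε : ∀ a ∈ o.block i, l a = ε a) {a : J} : (o.lt i a → l a = 0) ∧ (o.lt a i → l a = -1) := by
  obtain ⟨h0, h1⟩ := h
  push Not at h0 h1
  obtain ⟨b, hb, hb'⟩ := h0
  obtain ⟨c, hc, hc'⟩ := h1
  rw [← hε b hb] at hb'
  rw [← hε c hc] at hc'
  rw [mem_admissibleSeqs_iff] at hl
  exact ⟨fun h => (hl c a (lt_of_mem_left h hc)).resolve_left hc',
    fun h => (hl a b (lt_of_mem_right h hb)).resolve_right hb'⟩

theorem IsMixed.unique (h : IsMixed o ε i) (hε : ε ∈ admissibleSeqs o) {j : J}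
    (hj : IsMixed o ε j) : o.block j = o.block i := by
  by_contra hne
  have hji : ∀ a ∈ o.block j, a ∉ o.block i := fun a ha ha' =>
    hne ((block_eq ha).symm.trans (block_eq ha'))
  rcases lt_or_lt_of_notMem_block (hji j (self_mem_block j)) with hlt | hlt
  · exact hj.1 fun a ha => (h.eq_of_lt hε fun _ _ => rfl).1 (lt_of_mem_right hlt ha)
  · exact hj.2 fun a ha => (h.eq_of_lt hε fun _ _ => rfl).2 (lt_of_mem_left hlt ha)

/-- If l and ε differed outside [i], they would agree on [i], because differences are confined to
one class. Then [i] would force the same values 0 and -1 on both outside. -/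
theorem IsMixed.eq_off_block (h : IsMixed o ε i) (hε : ε ∈ admissibleSeqs o)
    (hl : l ∈ admissibleSeqs o) (hlε : Equivalent l ε) {a : J} (ha : a ∉ o.block i) :
    l a = ε a := by
  by_contra hne
  have hon : ∀ b ∈ o.block i, l b = ε b := by
    intro b hb
    by_contra hb'
    exact ha (mem_block_trans hb (mem_block_of_differ hε hl hlε hb' hne))
  have h1 := h.eq_of_lt hl hon (a := a)
  have h2 := h.eq_of_lt hε (fun _ _ => rfl) (a := a)
  rcases lt_or_lt_of_notMem_block ha with hlt | hlt
  · exact hne ((h1.1 hlt).trans (h2.1 hlt).symm)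
  · exact hne ((h1.2 hlt).trans (h2.2 hlt).symm)

/-- The entries on [i] are unrestricted, since ε is already 0 above and -1 below that class. -/
theorem IsMixed.mem_admissibleSeqs (h : IsMixed o ε i) (hε : ε ∈ admissibleSeqs o)
    (hl : ∀ a ∉ o.block i, l a = ε a) : l ∈ admissibleSeqs o := by
  have hε' := fun a => h.eq_of_lt hε (fun _ _ => rfl) (a := a)
  refine mem_admissibleSeqs_iff.2 fun a b hab => ?_
  by_cases ha : a ∈ o.block i
  · have hib := lt_of_mem_left hab (mem_block_symm ha)
    exact Or.inr ((hl b fun hb => (mem_block.1 hb).1 hib).trans ((hε' b).1 hib))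
  · by_cases hb : b ∈ o.block i
    · have hai := lt_of_mem_right hab (mem_block_symm hb)
      exact Or.inl ((hl a ha).trans ((hε' a).2 hai))
    · rw [hl a ha, hl b hb]
      exact mem_admissibleSeqs_iff.1 hε a b hab

theorem Equivalent.exists_lt_gt (h : Equivalent l ε) (hne : l ≠ ε) :
    ∃ (a b : J) (m n : ℤ), l a = ε a + m ∧ 0 < m ∧ l b = ε b + n ∧ n < 0 := by
  obtain ⟨z, hz, hz'⟩ := h.exists_finsupp
  have h0 : z ≠ 0 := by
    rintro rfl
    exact hne (funext fun i => by simp [hz'])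
  obtain ⟨⟨a, ha⟩, b, hb⟩ := exists_pos_and_neg hz h0
  exact ⟨a, b, z a, z b, hz' a, ha, hz' b, hb⟩

theorem ne_of_eq_add_int {x y : ℂ} {m : ℤ} (h : x = y + m) (hm : m ≠ 0) : x ≠ y := by
  rintro rfl
  exact hm (by simpa using h)

/-- A nonzero difference raises one entry and lowers another in the same class. On a class of zeros
the lowered entry becomes negative; on a class of -1's the raised one becomes nonnegative. Either
changes Int⁺. -/
theorem eq_of_forall_not_isMixed (hε : ε ∈ admissibleSeqs o) (hl : l ∈ admissibleSeqs o)
    (h : Equivalent l ε)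
    (hmix : ∀ i, (∀ a ∈ o.block i, ε a = 0) ∨ (∀ a ∈ o.block i, ε a = -1)) : l = ε := by
  by_contra hne
  obtain ⟨a, b, m, n, ha, hm, hb, hn⟩ := h.exists_lt_gt hne
  have hba := mem_block_of_differ hε hl h (ne_of_eq_add_int ha hm.ne') (ne_of_eq_add_int hb hn.ne)
  rcases hmix a with h0 | h1
  · have := h.nonneg_iff (i := b) (a := n) (b := 0) (by rw [hb, h0 b hba, zero_add])
      (by rw [h0 b hba]; simp)
    omega
  · have := h.nonneg_iff (i := a) (a := -1 + m) (b := -1)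
      (by rw [ha, h1 a (self_mem_block a)]; push_cast; rfl) (by rw [h1 a (self_mem_block a)]; simp)
    omega

/-- All variation is confined to the single index i, where it must vanish because the difference has
sum zero. -/
theorem IsMixed.eq_of_block_eq_singleton (h : IsMixed o ε i) (hε : ε ∈ admissibleSeqs o)
    (hl : l ∈ admissibleSeqs o) (hlε : Equivalent l ε) (hi : o.block i = {i}) : l = ε := by
  by_contra hne
  obtain ⟨a, b, m, n, ha, hm, hb, hn⟩ := hlε.exists_lt_gt hne
  have key : ∀ c, l c ≠ ε c → c = i := fun c hc => by
    by_contra hci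
    exact hc (h.eq_off_block hε hl hlε (by rw [hi]; exact hci))
  have hab := (key a (ne_of_eq_add_int ha hm.ne')).trans (key b (ne_of_eq_add_int hb hn.ne)).symm
  subst hab
  have : (m : ℂ) = n := by linear_combination hb - ha
  have : m = n := by exact_mod_cast this
  omega

/-- Sequences that agree off a set are equivalent if and only if their restrictions to it are. -/
theorem equivalent_restrict_iff {B : Set J} (h : ∀ a ∉ B, l a = ε a) :
    Equivalent (fun a : B => l a) (fun a : B => ε a) ↔ Equivalent l ε := by
  classical
  have hint : intPlus (fun a : B => l a) = intPlus (fun a : B => ε a) ↔ intPlus l = intPlus ε := by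
    constructor
    · intro h'
      ext a
      by_cases ha : a ∈ B
      · exact Set.ext_iff.1 h' ⟨a, ha⟩
      · change (∃ n : ℕ, l a = n) ↔ ∃ n : ℕ, ε a = n
        rw [h a ha]
    · intro h'
      ext a
      exact Set.ext_iff.1 h' a.1
  unfold Equivalent
  rw [hint, and_congr_left_iff]
  intro _
  rw [mem_rootLattice_iff, mem_rootLattice_iff]
  constructor
  · rintro ⟨z, hz, hz'⟩
    refine ⟨z.mapDomain Subtype.val, ?_, fun a => ?_⟩
    · rw [Finsupp.sum_mapDomain_index_inj Subtype.val_injective]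
      exact hz
    · by_cases ha : a ∈ B
      · rw [Finsupp.mapDomain_apply Subtype.val_injective z ⟨a, ha⟩, ← hz']
        rfl
      · rw [Finsupp.mapDomain_of_notMem_range _ _ (by simpa using ha), Pi.sub_apply, h a ha]
        simp
  · rintro ⟨z, hz, hz'⟩
    refine ⟨z.subtypeDomain (· ∈ B), ?_, fun a => hz' a.1⟩
    rw [← hz]
    refine Finsupp.sum_subtypeDomain_index (h := fun _ n => n) fun a ha => ?_
    by_contra haB
    rw [Finsupp.mem_support_iff] at ha
    have := hz' a
    rw [Pi.sub_apply, h a haB, sub_self] at this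
    exact ha (by exact_mod_cast this.symm)

end

section

variable {J : Type}

/-! ### The `u(≺)`-invariants of `X(μ)` -/

variable (o : AdmissibleOrder J) (μ : J → ℂ)

theorem cartan_le_levi : cartan J ≤ levi o := fun x hx i j h => by
  obtain rfl := hx i j h
  exact self_mem_block i

theorem slE_mem_levi {i j : J} (h : i ≠ j) (hij : j ∈ o.block i) : slE h ∈ levi o := by
  intro a b hab
  have hab' : (E i j) (a, b) ≠ 0 := hab
  classical
  rw [E_apply] at hab'
  obtain ⟨rfl, rfl⟩ := of_not_not fun h => hab' (if_neg h)
  exact hij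

theorem slE_mem_nilradical {i j : J} (h : i ≠ j) (hij : o.lt i j) : slE h ∈ nilradical o := by
  intro a b hab
  have hab' : (E i j) (a, b) ≠ 0 := hab
  classical
  rw [E_apply] at hab'
  obtain ⟨rfl, rfl⟩ := of_not_not fun h => hab' (if_neg h)
  exact hij

variable {o μ}

/-- For i ≺ j, the operator `E_ij` kills x^l in X(μ) exactly when l_i = -1 or l_j = 0, which is the
pointwise form of membership in S(≺). -/
theorem basisX_mem_invariants_iff {l : {l : J → ℂ // Equivalent l μ}} :
    basisX μ l ∈ invariants o (X μ) ↔ l.1 ∈ admissibleSeqs o := by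
  rw [mem_admissibleSeqs_iff]
  constructor
  · intro h a b hab
    by_contra! hne
    have hab' : a ≠ b := by rintro rfl; exact o.irrefl a hab
    have h0 := h _ (slE_mem_nilradical o hab' hab)
    have heq := (equivalent_shift hab' hne.2 hne.1).trans l.2
    rw [slE_lie_basisX, monoX_of_equivalent heq] at h0
    exact smul_ne_zero hne.2 ((basisX μ).ne_zero _) h0
  · intro h x hx
    rw [lie_basisX]
    rw [lift_congr (g := fun _ _ => (0 : X μ))]
    · exact Finset.sum_eq_zero fun _ _ => smul_zero _
    · intro i j hij
      rcases h i j (hx i j hij) with h | h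
      · have hne : i ≠ j := by rintro rfl; exact o.irrefl i (hx i i hij)
        rw [monoX_of_not_equivalent, smul_zero]
        exact fun h' => not_equivalent_shift hne h (h'.trans l.2.symm)
      · rw [h, zero_smul]

theorem basisX_mem_invariants_of_repr_ne_zero {m : X μ} (hm : m ∈ invariants o (X μ))
    {l : {l : J → ℂ // Equivalent l μ}} (hl : (basisX μ).repr m l ≠ 0) :
    basisX μ l ∈ invariants o (X μ) := by
  refine basis_mem_of_repr_ne_zero (basisX μ) (invariants o (X μ)).toSubmodule
    (fun k l h => ?_) hm hl
  obtain ⟨x, hx, hne⟩ := X_separated k l h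
  exact ⟨LieModule.toEnd ℂ (sl J) (X μ) x, fun l => weight l.1 x.1,
    fun m hm => (invariants o (X μ)).lie_mem (x := ⟨x, cartan_le_levi o hx⟩) hm,
    lie_basisX_of_mem_cartan hx, hne⟩

/-- The monomial `x^l` as an element of `X(μ)^{u(≺)}`. -/
def monoInv (l : {l : J → ℂ // Equivalent l μ ∧ l ∈ admissibleSeqs o}) : invariants o (X μ) :=
  ⟨basisX μ ⟨l.1, l.2.1⟩, basisX_mem_invariants_iff.2 l.2.2⟩

variable (o μ) in
/-- The basis of `X(μ)^{u(≺)}` consisting of the monomials with exponent in `S(≺)`. -/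
def basisInv : Module.Basis {l : J → ℂ // Equivalent l μ ∧ l ∈ admissibleSeqs o} ℂ
    (invariants o (X μ)) :=
  .mk (v := monoInv)
    (by
      refine LinearIndependent.of_comp (invariants o (X μ)).toSubmodule.subtype ?_
      exact (basisX μ).linearIndependent.comp
        (fun l : {l : J → ℂ // Equivalent l μ ∧ l ∈ admissibleSeqs o} => ⟨l.1, l.2.1⟩)
        fun k l h => Subtype.ext (Subtype.mk.inj h))
    (by
      rintro m -
      have h : m.1 ∈ (Submodule.span ℂ (Set.range (monoInv (o := o) (μ := μ)))).map
          (invariants o (X μ)).toSubmodule.subtype := by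
        rw [← (basisX μ).linearCombination_repr m.1]
        refine sum_mem fun l hl => Submodule.smul_mem _ _ ?_
        have hl' := basisX_mem_invariants_iff.1
          (basisX_mem_invariants_of_repr_ne_zero m.2 (Finsupp.mem_support_iff.1 hl))
        exact ⟨monoInv ⟨l.1, l.2, hl'⟩, Submodule.subset_span ⟨_, rfl⟩, rfl⟩
      obtain ⟨m', hm', h⟩ := h
      rwa [← Subtype.ext h])

theorem basisInv_coe (l : {l : J → ℂ // Equivalent l μ ∧ l ∈ admissibleSeqs o}) :
    (basisInv o μ l).1 = basisX μ ⟨l.1, l.2.1⟩ := by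
  rw [basisInv, Module.Basis.mk_apply]
  rfl

theorem lie_basisInv_of_mem_cartan {x : levi o} (hx : x.1 ∈ cartan J)
    (l : {l : J → ℂ // Equivalent l μ ∧ l ∈ admissibleSeqs o}) :
    ⁅x, basisInv o μ l⁆ = weight l.1 x.1.1 • basisInv o μ l := by
  refine Subtype.ext ?_
  change ⁅x.1, (basisInv o μ l).1⁆ = weight l.1 x.1.1 • (basisInv o μ l).1
  rw [basisInv_coe]
  exact lie_basisX_of_mem_cartan hx _

theorem invariants_isWeightModule :
    IsWeightModule ((cartan J).comap (levi o).incl) (invariants o (X μ)) := by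
  refine isWeightModule_of_basis (basisInv o μ) _
    (fun l => weight l.1 ∘ₗ (sl J).toSubmodule.subtype ∘ₗ (levi o).toSubmodule.subtype ∘ₗ
      ((cartan J).comap (levi o).incl).toSubmodule.subtype)
    (fun h l => lie_basisInv_of_mem_cartan h.2 l) fun k l h => ?_
  by_contra hne
  obtain ⟨x, hx, hx'⟩ := X_separated ⟨k.1, k.2.1⟩ ⟨l.1, l.2.1⟩
    fun h => hne (Subtype.ext (Subtype.mk.inj h))
  exact hx' (LinearMap.congr_fun h ⟨⟨x, cartan_le_levi o hx⟩, hx⟩)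

/-- Two basis exponents differ only inside one class, so the moves joining them use root vectors of
l(≺) alone. -/
theorem invariants_isIrreducible (h : ∃ l ∈ admissibleSeqs o, Equivalent l μ) :
    LieModule.IsIrreducible ℂ (levi o) (invariants o (X μ)) := by
  obtain ⟨l, hl, hlμ⟩ := h
  have : Nonempty {l : J → ℂ // Equivalent l μ ∧ l ∈ admissibleSeqs o} := ⟨⟨l, hlμ, hl⟩⟩
  refine isIrreducible_of_basis (basisInv o μ) (fun k l h => ?_) fun N k l hk => ?_
  · obtain ⟨x, hx, hne⟩ := X_separated ⟨k.1, k.2.1⟩ ⟨l.1, l.2.1⟩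
      fun h' => h (Subtype.ext (Subtype.mk.inj h'))
    exact ⟨⟨x, cartan_le_levi o hx⟩, fun l => weight l.1 x.1, lie_basisInv_of_mem_cartan hx, hne⟩
  · by_cases hkl : ∃ a, k.1 a ≠ l.1 a
    · obtain ⟨a, ha⟩ := hkl
      have hmem : basisX μ ⟨l.1, l.2.1⟩ ∈
          N.toSubmodule.map (invariants o (X μ)).toSubmodule.subtype := by
        refine basisX_mem_of_mem _ (o.block a) ?_ ⟨k.1, k.2.1⟩ _ (fun b hb => ?_) ?_
        · rintro i hi j hj hij _ ⟨m, hm, rfl⟩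
          exact ⟨_, N.lie_mem (x := ⟨slE hij, slE_mem_levi o hij
            (mem_block_trans (mem_block_symm hi) hj)⟩) hm, rfl⟩
        · by_contra hb'
          exact hb (mem_block_of_differ l.2.2 k.2.2 (k.2.1.trans l.2.1.symm) ha hb')
        · exact ⟨_, hk, basisInv_coe k⟩
      obtain ⟨m, hm, hm'⟩ := hmem
      have : m = basisInv o μ l := Subtype.ext (hm'.trans (basisInv_coe l).symm)
      rwa [← this]
    · push Not at hkl
      have : k = l := Subtype.ext (funext hkl)
      rwa [← this]

theorem invariants_ne_bot_iff :
    invariants o (X μ) ≠ ⊥ ↔ ∃ l ∈ admissibleSeqs o, Equivalent μ l := by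
  constructor
  · intro h
    obtain ⟨m, hm, hm0⟩ := Submodule.exists_mem_ne_zero_of_ne_bot
      (mt (LieSubmodule.toSubmodule_eq_bot _).1 h)
    obtain ⟨l, hl⟩ := Finsupp.ne_iff.1 fun h => hm0 ((basisX μ).repr.map_eq_zero_iff.1 h)
    exact ⟨l.1, basisX_mem_invariants_iff.1 (basisX_mem_invariants_of_repr_ne_zero hm hl),
      l.2.symm⟩
  · rintro ⟨l, hl, hlμ⟩ h
    have hmem := basisX_mem_invariants_iff (l := ⟨l, hlμ.symm⟩).2 hl
    rw [h, LieSubmodule.mem_bot] at hmem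
    exact (basisX μ).ne_zero _ hmem

/-- Alignment is equivalent to having nonzero invariants; in the converse direction the inducing
module S is the space of invariants itself. -/
theorem isAligned_X_iff :
    IsAligned o (X μ) ↔ ∃ ε ∈ admissibleSeqs o, Equivalent μ ε := by
  have hirr := X_isIrreducible μ
  rw [← invariants_ne_bot_iff]
  constructor
  · rintro ⟨-, -, S, _, _, _, _, -, -, f, hf⟩
    have := LieModule.nontrivial_of_isIrreducible ℂ (sl J) (X μ)
    exact invariants_ne_bot_of_surjective f hf
  · intro h
    obtain ⟨ε, hε, hμε⟩ := invariants_ne_bot_iff.1 h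
    exact ⟨hirr, X_isWeightModule μ, invariants o (X μ), inferInstance, inferInstance,
      inferInstance, inferInstance, invariants_isIrreducible ⟨ε, hε, hμε.symm⟩,
      invariants_isWeightModule, exists_genVerma_surjective h⟩

/-- If `S(≺)` contains only one element equivalent to `μ`, the invariants are trivial. -/
theorem invariants_equiv_trivial {ε : J → ℂ} (hε : ε ∈ admissibleSeqs o) (hμε : Equivalent μ ε)
    (huniq : ∀ l ∈ admissibleSeqs o, Equivalent l ε → l = ε) :
    Nonempty (invariants o (X μ) ≃ₗ⁅ℂ, leviSS o⁆ TrivialLieModule ℂ (leviSS o) ℂ) := by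
  let _ : Unique {l : J → ℂ // Equivalent l μ ∧ l ∈ admissibleSeqs o} :=
    { default := ⟨ε, hμε.symm, hε⟩
      uniq := fun l => Subtype.ext (huniq l.1 l.2.2 (l.2.1.trans hμε)) }
  let f : invariants o (X μ) ≃ₗ[ℂ] TrivialLieModule ℂ (leviSS o) ℂ :=
    (basisInv o μ).equiv (Module.Basis.singleton Unit ℂ) (Equiv.ofUnique _ _)
  exact ⟨{ f with
    map_lie' := fun {x m} => by
      have h : ⁅x, m⁆ = 0 := lie_derived_eq_zero (basisInv o μ) x m
      change f ⁅x, m⁆ = ⁅x, f m⁆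
      rw [h, map_zero, trivial_lie_zero] }⟩

/-! ### The invariants in the presence of a mixed class -/

/-- An element of `l(≺)^ss` has trace zero on every union of classes. -/
theorem trace_restrict_leviSS (P : Set J) (hP : ∀ a ∈ P, o.block a ⊆ P) (A : leviSS o) :
    trace (restrict P A.1.1.1) = 0 := by
  have h : (leviSS o).toSubmodule ≤ LinearMap.ker (FinMat.trace ∘ₗ restrict P ∘ₗ
      (sl J).toSubmodule.subtype ∘ₗ (levi o).toSubmodule.subtype) := by
    rw [LieSubmodule.lieIdeal_oper_eq_linear_span']
    refine Submodule.span_le.2 ?_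
    rintro _ ⟨A, _, B, _, rfl⟩
    change trace (restrict P ⁅A.1.1, B.1.1⁆) = 0
    rw [lie_def, map_sub, restrict_mul _ _ _ fun i j h hi => hP i hi (A.2 i j h),
      restrict_mul _ _ _ fun i j h hi => hP i hi (B.2 i j h), ← lie_def, trace_lie]
  exact h A.2

/-- Restriction of exponents to the class `[i]`, as a map from `X(μ)` to `X(ε_[i])`. -/
def restrictX (o : AdmissibleOrder J) (μ ε : J → ℂ) (i : J) :
    X μ →ₗ[ℂ] X (fun a : o.block i => ε a) :=
  (basisX μ).constr ℂ fun l => monoX (fun a : o.block i => ε a) fun a => l.1 a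

variable {ε : J → ℂ} {i : J}

/-- For exponents that agree with ε off [i], vanishing of the monomial is detected on [i]. The
formula thus also covers shifts that leave the equivalence class. -/
theorem restrictX_monoX (hμε : Equivalent μ ε) {l : J → ℂ} (hl : ∀ a ∉ o.block i, l a = ε a) :
    restrictX o μ ε i (monoX μ l) = monoX (fun a : o.block i => ε a) fun a => l a := by
  by_cases h : Equivalent l μ
  · rw [monoX_of_equivalent h, restrictX, Module.Basis.constr_basis]
  · rw [monoX_of_not_equivalent h, monoX_of_not_equivalent, map_zero]
    rw [equivalent_restrict_iff hl]
    exact fun h' => h (h'.trans hμε.symm)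

theorem restrict_shift {B : Set J} (l : J → ℂ) (a b : B) :
    (fun c : B => (l - e b.1 + e a.1) c) = (fun c : B => l c) - e b + e a := by
  funext c
  have h : ∀ d : B, e d.1 c.1 = e d c := fun d => by
    by_cases hd : c = d
    · rw [hd, e_self, e_self]
    · rw [e_of_ne hd, e_of_ne (Subtype.coe_ne_coe.2 hd)]
  simp only [Pi.add_apply, Pi.sub_apply, h]

theorem IsMixed.eq_zero_or_of_not_mem (h : IsMixed o ε i) (hε : ε ∈ admissibleSeqs o) {a : J}
    (ha : a ∉ o.block i) : (∀ b ∈ o.block a, ε b = 0) ∨ (∀ b ∈ o.block a, ε b = -1) := by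
  by_contra! hne
  have : IsMixed o ε a := by
    unfold IsMixed
    push Not
    exact hne
  exact ha (h.unique hε this ▸ self_mem_block a)

/-- Elements of `l(≺)^ss` act on the part of a weight outside a mixed class by zero. -/
theorem IsMixed.weight_off_block_eq_zero (h : IsMixed o ε i) (hε : ε ∈ admissibleSeqs o)
    (A : leviSS o) [DecidablePred (· ∈ o.block i)] :
    weight (fun a => if a ∈ o.block i then 0 else ε a) A.1.1.1 = 0 := by
  classical
  -- Outside [i] every class is constantly 0 or -1, so P is a union of classes and the functional is
  -- minus the trace over P.
  let P : Set J := {a | a ∉ o.block i ∧ ε a = -1}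
  have hP : ∀ a ∈ P, o.block a ⊆ P := by
    rintro a ⟨ha, ha'⟩ b hb
    refine ⟨fun hb' => ha (mem_block_trans hb' (mem_block_symm hb)), ?_⟩
    rcases h.eq_zero_or_of_not_mem hε ha with h0 | h1
    · rw [h0 a (self_mem_block a)] at ha'
      norm_num at ha'
    · exact h1 b hb
  have heq : weight (fun a => if a ∈ o.block i then 0 else ε a) =
      -(trace ∘ₗ restrict P) := by
    refine linearMap_ext fun a b => ?_
    rw [weight, lift_E, LinearMap.neg_apply, LinearMap.comp_apply, restrict_E]
    by_cases hab : a = b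
    · subst hab
      rw [if_pos rfl]
      by_cases haP : a ∈ P
      · rw [dif_pos ⟨haP, haP⟩, trace_E, if_pos rfl, if_neg haP.1, haP.2]
      · rw [dif_neg fun h => haP h.1, map_zero, neg_zero]
        split_ifs with hai
        · rfl
        · rcases h.eq_zero_or_of_not_mem hε hai with h0 | h1
          · exact h0 a (self_mem_block a)
          · exact (haP ⟨hai, h1 a (self_mem_block a)⟩).elim
    · rw [if_neg hab]
      split_ifs with hP
      · rw [trace_E, if_neg fun h => hab (congrArg Subtype.val h), neg_zero]
      · simp
  rw [heq, LinearMap.neg_apply, LinearMap.comp_apply, trace_restrict_leviSS P hP, neg_zero]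

/-- Entries of A in the block [i] act on both sides alike. In any other block ε is constantly 0 or
-1, so off-diagonal entries kill the monomial and diagonal ones act by a scalar; these scalars add
up to a character vanishing on l(≺)^ss. -/
theorem IsMixed.restrictX_lie (h : IsMixed o ε i) (hε : ε ∈ admissibleSeqs o)
    (hμε : Equivalent μ ε) (A : leviSS o)
    (l : {l : J → ℂ // Equivalent l μ ∧ l ∈ admissibleSeqs o}) :
    restrictX o μ ε i ⁅A.1.1, basisX μ ⟨l.1, l.2.1⟩⁆ =
      ⁅blockProj o i A, restrictX o μ ε i (basisX μ ⟨l.1, l.2.1⟩)⁆ := by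
  classical
  have hl : ∀ a ∉ o.block i, l.1 a = ε a := fun a ha =>
    h.eq_off_block hε l.2.2 (l.2.1.trans hμε) ha
  set lr : o.block i → ℂ := fun a => l.1 a
  set εr : o.block i → ℂ := fun a => ε a
  have hequiv : Equivalent lr εr := (equivalent_restrict_iff hl).2 (l.2.1.trans hμε)
  have hbasis : restrictX o μ ε i (basisX μ ⟨l.1, l.2.1⟩) = basisX εr ⟨lr, hequiv⟩ := by
    rw [basisX_eq_monoX, restrictX_monoX hμε hl, basisX_eq_monoX]
  rw [hbasis, lie_basisX, lie_basisX, map_lift]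
  let ρ : o.block i → o.block i → X εr := fun a b => lr b • monoX εr (lr - e b + e a)
  let w : J → ℂ := fun a => if a ∈ o.block i then 0 else ε a
  have hterm : ∀ a b, A.1.1.1 (a, b) ≠ 0 →
      restrictX o μ ε i (l.1 b • monoX μ (l.1 - e b + e a)) =
        (lift ρ ∘ₗ restrict (o.block i) +
          (LinearMap.toSpanSingleton ℂ (X εr) (basisX εr ⟨lr, hequiv⟩)) ∘ₗ weight w) (E a b) := by
    intro a b hab
    have hba : b ∈ o.block a := A.1.2 a b hab
    rw [LinearMap.add_apply, LinearMap.comp_apply, LinearMap.comp_apply, restrict_E, weight, lift_E,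
      map_smul]
    by_cases ha : a ∈ o.block i
    · have hb : b ∈ o.block i := mem_block_trans ha hba
      have hw : (if a = b then w a else 0) = 0 := by simp [w, ha]
      rw [dif_pos ⟨ha, hb⟩, lift_E, hw, map_zero, add_zero, restrictX_monoX hμε]
      · exact congrArg (fun f => l.1 b • monoX εr f) (restrict_shift l.1 ⟨a, ha⟩ ⟨b, hb⟩)
      · intro c hc
        have hca : c ≠ a := fun h => hc (h ▸ ha)
        have hcb : c ≠ b := fun h => hc (h ▸ hb)
        simp [e_of_ne hca, e_of_ne hcb, hl c hc]
    · have hb : b ∉ o.block i := fun hb => ha (mem_block_trans hb (mem_block_symm hba))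
      rw [dif_neg fun h => ha h.1, map_zero, zero_add]
      by_cases hab' : a = b
      · subst hab'
        rw [if_pos rfl, sub_add_cancel, ← hbasis, LinearMap.toSpanSingleton_apply]
        simp only [w, if_neg ha, ← hl a ha, basisX_eq_monoX]
      · rw [if_neg hab', map_zero]
        rcases h.eq_zero_or_of_not_mem hε ha with h0 | h1
        · rw [hl b hb, h0 b hba, zero_smul]
        · rw [monoX_of_not_equivalent, map_zero, smul_zero]
          refine fun h' => not_equivalent_shift hab' ?_ (h'.trans l.2.1.symm)
          rw [hl a ha, h1 a (self_mem_block a)]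
  rw [lift_congr hterm, ← map_lift]
  -- Summing the comparison over the entries of A reassembles A itself.
  have hlift : lift E A.1.1.1 = A.1.1.1 :=
    LinearMap.congr_fun (linearMap_ext (f := lift E) (g := LinearMap.id) fun a b => lift_E _ _ _) _
  rw [hlift, LinearMap.add_apply, LinearMap.comp_apply, LinearMap.comp_apply,
    h.weight_off_block_eq_zero hε, map_zero, add_zero]
  rfl

/-- Exponents in S(≺) equivalent to ε correspond to exponents on [i] equivalent to ε_[i]: restrict
in one direction, extend by ε in the other. The resulting bijection of bases is induced by
`restrictX`, which gives equivariance. -/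
theorem IsMixed.invariants_equiv (h : IsMixed o ε i) (hε : ε ∈ admissibleSeqs o)
    (hμε : Equivalent μ ε) :
    Nonempty (invariants o (X μ) ≃ₗ⁅ℂ, leviSS o⁆ BoxTrivial o i ε) := by
  classical
  let idx : {l : J → ℂ // Equivalent l μ ∧ l ∈ admissibleSeqs o} ≃
      {l : o.block i → ℂ // Equivalent l fun a => ε a} :=
    { toFun := fun l => ⟨fun a => l.1 a, (equivalent_restrict_iff fun a ha =>
        h.eq_off_block hε l.2.2 (l.2.1.trans hμε) ha).2 (l.2.1.trans hμε)⟩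
      invFun := fun l => ⟨fun a => if ha : a ∈ o.block i then l.1 ⟨a, ha⟩ else ε a, by
        have hoff : ∀ a ∉ o.block i,
            (if ha : a ∈ o.block i then l.1 ⟨a, ha⟩ else ε a) = ε a := fun a ha => dif_neg ha
        refine ⟨((equivalent_restrict_iff hoff).1 ?_).trans hμε.symm,
          h.mem_admissibleSeqs hε hoff⟩
        have : (fun a : o.block i => if ha : a.1 ∈ o.block i then l.1 ⟨a, ha⟩ else ε a) = l.1 :=
          funext fun a => dif_pos a.2
        rw [this]
        exact l.2⟩
      left_inv := fun l => Subtype.ext (funext fun a => by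
        by_cases ha : a ∈ o.block i
        · exact dif_pos ha
        · exact (dif_neg ha).trans (h.eq_off_block hε l.2.2 (l.2.1.trans hμε) ha).symm)
      right_inv := fun l => Subtype.ext (funext fun a => dif_pos a.2) }
  let f : invariants o (X μ) ≃ₗ[ℂ] X (fun a : o.block i => ε a) :=
    (basisInv o μ).equiv (basisX _) idx
  have hf : ∀ m, f m = restrictX o μ ε i m.1 := by
    intro m
    have : f.toLinearMap = restrictX o μ ε i ∘ₗ (invariants o (X μ)).toSubmodule.subtype := by
      refine (basisInv o μ).ext fun l => ?_
      change f (basisInv o μ l) = restrictX o μ ε i (basisInv o μ l).1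
      rw [Module.Basis.equiv_apply, basisInv_coe, basisX_eq_monoX, basisX_eq_monoX,
        restrictX_monoX hμε fun a ha => h.eq_off_block hε l.2.2 (l.2.1.trans hμε) ha]
      rfl
    exact LinearMap.congr_fun this m
  have hlie : ∀ (A : leviSS o) (m : invariants o (X μ)), f ⁅A, m⁆ = ⁅blockProj o i A, f m⁆ := by
    intro A m
    have : f.toLinearMap ∘ₗ LieModule.toEnd ℂ (leviSS o) (invariants o (X μ)) A =
        LieModule.toEnd ℂ (sl (o.block i)) _ (blockProj o i A) ∘ₗ f.toLinearMap := by
      refine (basisInv o μ).ext fun l => ?_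
      change f ⁅A, basisInv o μ l⁆ = ⁅blockProj o i A, f (basisInv o μ l)⁆
      rw [hf, hf, basisInv_coe, ← h.restrictX_lie hε hμε A l, ← basisInv_coe]
      rfl
    exact LinearMap.congr_fun this m
  exact ⟨{ f with map_lie' := fun {A m} => hlie A m }⟩

end

end

end SlInf

/-! ### The proposition for `sl(∞)` -/

theorem mainTheorem1 (o : SlInf.AdmissibleOrder ℕ+) (μ : ℕ+ → ℂ) :
    (SlInf.IsAligned o (SlInf.X μ) ↔
      ∃ ε ∈ SlInf.admissibleSeqs o, SlInf.Equivalent μ ε) ∧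
    ∀ ε ∈ SlInf.admissibleSeqs o, SlInf.Equivalent μ ε →
      (∃ i : ℕ+,
        (¬ (∀ a ∈ o.block i, ε a = 0) ∧ ¬ (∀ a ∈ o.block i, ε a = -1)) ∧
        (∀ j : ℕ+, ¬ (∀ a ∈ o.block j, ε a = 0) → ¬ (∀ a ∈ o.block j, ε a = -1) →
          o.block j = o.block i) ∧
        ((2 ≤ (o.block i).encard ∧
            Nonempty (SlInf.invariants o (SlInf.X μ) ≃ₗ⁅ℂ, SlInf.leviSS o⁆
              SlInf.BoxTrivial o i ε)) ∨
          ((o.block i).encard = 1 ∧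
            Nonempty (SlInf.invariants o (SlInf.X μ) ≃ₗ⁅ℂ, SlInf.leviSS o⁆
              TrivialLieModule ℂ (SlInf.leviSS o) ℂ)))) ∨
      ((∀ i : ℕ+, (∀ a ∈ o.block i, ε a = 0) ∨ (∀ a ∈ o.block i, ε a = -1)) ∧
        Nonempty (SlInf.invariants o (SlInf.X μ) ≃ₗ⁅ℂ, SlInf.leviSS o⁆
          TrivialLieModule ℂ (SlInf.leviSS o) ℂ)) := by
  refine ⟨SlInf.isAligned_X_iff, fun ε hε hμε => ?_⟩
  by_cases hmix : ∃ i, SlInf.IsMixed o ε i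
  · obtain ⟨i, hi⟩ := hmix
    refine Or.inl ⟨i, hi, fun j h0 h1 => hi.unique hε ⟨h0, h1⟩, ?_⟩
    have hne : (o.block i).Nonempty := ⟨i, SlInf.AdmissibleOrder.self_mem_block i⟩
    rcases hne.exists_eq_singleton_or_nontrivial with ⟨a, ha⟩ | hnt
    · obtain rfl : i = a := by
        have := SlInf.AdmissibleOrder.self_mem_block (o := o) i
        rwa [ha] at this
      refine Or.inr ⟨by rw [ha, Set.encard_singleton], ?_⟩
      exact SlInf.invariants_equiv_trivial hε hμε fun l hl hlε =>
        hi.eq_of_block_eq_singleton hε hl hlε ha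
    · refine Or.inl ⟨?_, hi.invariants_equiv hε hμε⟩
      have := Order.add_one_le_of_lt (Set.one_lt_encard_iff_nontrivial.2 hnt)
      rwa [one_add_one_eq_two] at this
  · have hmix' : ∀ i, (∀ a ∈ o.block i, ε a = 0) ∨ (∀ a ∈ o.block i, ε a = -1) := fun i => by
      by_contra h
      exact hmix ⟨i, not_or.1 h⟩
    exact Or.inr ⟨hmix', SlInf.invariants_equiv_trivial hε hμε fun l hl hlε =>
      SlInf.eq_of_forall_not_isMixed hε hl hlε hmix'⟩
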